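/- Let $A\in\mathbb{Z}^{d\times n}$ be an integer matrix with nonzero columns $a_1,\dots,a_n$ such that $\mathbb{Z}A=\mathbb{Z}^d$ and the semigroup $\mathbb{N}A$ is positive (its only invertible element is $0$), and let $L=(L_1,\dots,L_n)\in\mathbb{Q}^n$ be a weight vector. Let $R=\mathbb{C}[\partial_1,\dots,\partial_n]$, graded by $\mathbb{Z}^d$ via $\deg\partial_j=a_j$. For $\tau\subseteq\{1,\dots,n\}$ let $I_A^\tau\subseteq R$ be the ideal generated by the binomials $\partial^{u_+}-\partial^{u_-}$ with $u\in\mathbb{Z}^n$ supported in $\tau$ and $Au=0$, and by the variables $\partial_j$ with $j\notin\tau$; put $S_\tau=R/I_A^\tau$ and $I_A=I_A^{\{1,\dots,n\}}$. Let $I_A^L=\mathrm{gr}^L(I_A)$ be the ideal generated by the $L$-symbols (sums of the terms of maximal $L$-degree) of the elements of $I_A$, and let $S_A^L=R/I_A^L$. Let $O_A^\tau\subseteq\mathbb{C}^n$ be the orbit of the point $\mathbf 1_A^\tau$ (with $j$-th coordinate $1$ for $j\in\tau$ and $0$ for $j\notin\tau$) under the action $t\cdot\xi=(t^{a_1}\xi_1,\dots,t^{a_n}\xi_n)$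 of the torus $(\mathbb{C}^*)^d$, and $\bar O_A^\tau$ its Zariski closure. Regard $\mathbb{Q}^d$ as a subset of $\mathbb{P}^d_{\mathbb{Q}}$ via $q\mapsto(q:1)$ and let $a_j^L=(a_j:L_j)\in\mathbb{P}^d_{\mathbb{Q}}$ (that is, $a_j/L_j$ if $L_j\neq0$, and a point at infinity if $L_j=0$). Choose a linear form $h$ on $\mathbb{Q}^d$ with $h(a_j)>0$ for all $j$ and a rational $\varepsilon>0$ with $\varepsilon<|h(a_j)/L_j|$ whenever $L_j\ne0$. Let $\Delta_A^L$ be the convex hull of $0,a_1^L,\dots,a_n^L$ in the affine space that is the complement in $\mathbb{P}^d_{\mathbb{Q}}$ of the closure of $h^{-1}(-\varepsilon)$. The $(A,L)$-umbrella $\Phi_A^L$ is the set of faces of $\Delta_A^L$ (including the empty face) that do not contain $0$, a face being identified with the set $\tau$ of those $j$ for which it contains $a_j^L$; it does not depend on the choice of $h$ and $\varepsilon$. Let $\Phi_A^{L,d-1}$ be the set of its facets, i.e. of the $\tau\in\Phi_A^L$ with $\dim_{\mathbb{Q}}\mathbb{Q}\tau=d$, where $\mathbb{Q}\tau$ and $\mathbb{Z}\tau$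 are the $\mathbb{Q}$-span and the $\mathbb{Z}$-span of the $a_j$ with $j\in\tau$. There is a chain $0=N_0\subsetneq N_1\subsetneq\dots\subsetneq N_l=S_A^L$ of $\mathbb{Z}^d$-graded $R$-modules with $N_i/N_{i-1}\cong S_{\tau_i}(-u_i)$ as graded modules for some $\tau_i\in\Phi_A^L$ and $u_i\in\mathbb{Z}^d$. For each $\tau\in\Phi_A^{L,d-1}$ let the multiplicity $\nu_A^{L,\tau}$ of $S_A^L$ along $\bar O_A^\tau$ be the number of indices $i$ with $\tau_i=\tau$ in such a chain. Then, for every such chain, $$\nu_A^{L,\tau}=[\mathbb{Z}^d:\mathbb{Z}\tau]\qquad\text{for all }\tau\in\Phi_A^{L,d-1}.$$ In particular $\nu_A^{L,\tau}$ does not depend on the chain. Moreover, the vanishing ideal of $\bar O_A^\tau$ is prime, and $\nu_A^{L,\tau}$ is also the length of the localization of $S_A^L$ at this prime ideal. Consequently, the degree of $I_A^L$, in the sense of the number of irreducible components of maximal dimension of $\mathrm{Spec}(S_A^L)$ counted with multiplicity (that is, $\sum_P\operatorname{length}\,(R/I_A^L)_P$ over the minimal primes $P$ of $I_A^L$ with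 $\dim R/P=\dim R/I_A^L$), equals $$\sum_{\tau\in\Phi_A^{L,d-1}}\nu_A^{L,\tau}=\sum_{\tau\in\Phi_A^{L,d-1}}[\mathbb{Z}^d:\mathbb{Z}\tau].$$ -/

import Mathlib

open MvPolynomial

noncomputable section

namespace Umbrella

variable {d n : ℕ}

/-! ### Standing assumptions on the matrix -/

/-- The columns `a_1, …, a_n ∈ ℤ^d` of `A` are nonzero, generate `ℤ^d` as a group, and the
semigroup `ℕA` is positive: its only invertible element is `0`. -/
structure IsAdmissible (A : Matrix (Fin d) (Fin n) ℤ) : Prop where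
  col_ne_zero : ∀ j, A.col j ≠ 0
  span_eq_top : AddSubgroup.closure (Set.range A.col) = ⊤
  positive : ∀ x ∈ AddSubmonoid.closure (Set.range A.col),
    -x ∈ AddSubmonoid.closure (Set.range A.col) → x = 0

/-! ### Toric ideals and torus orbits

The polynomial ring `R = ℂ[∂_1, …, ∂_n]` is `MvPolynomial (Fin n) ℂ`, with `∂_j = X j`. -/

/-- The binomial `□_u = ∂^{u₊} - ∂^{u₋}`. -/
def box (u : Fin n → ℤ) : MvPolynomial (Fin n) ℂ :=
  ∏ j, X j ^ (u j).toNat - ∏ j, X j ^ (-u j).toNat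

/-- The ideal `I_A^τ = R · I_τ + J_τ`: it is generated by the binomials `□_u` with `A u = 0` and
`u` supported in `τ`, and by the variables `∂_j` with `j ∉ τ`. -/
def toricIdeal (A : Matrix (Fin d) (Fin n) ℤ) (τ : Finset (Fin n)) :
    Ideal (MvPolynomial (Fin n) ℂ) :=
  Ideal.span {f | ∃ u : Fin n → ℤ, A.mulVec u = 0 ∧ (∀ j ∉ τ, u j = 0) ∧ f = box u} ⊔
    Ideal.span {f | ∃ j ∉ τ, f = X j}

/-- The action of the torus `(ℂ^*)^d` on `ℂ^n`, `t · ξ = (t^{a_1} ξ_1, …, t^{a_n} ξ_n)`. -/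
def torusAct (A : Matrix (Fin d) (Fin n) ℤ) (t : Fin d → ℂˣ) (ξ : Fin n → ℂ) : Fin n → ℂ :=
  fun j => ((∏ i, t i ^ A i j : ℂˣ) : ℂ) * ξ j

/-- The orbit `O_A^τ` of the point `1_A^τ`, whose `j`-th coordinate is `1` if `j ∈ τ` and `0`
otherwise. -/
def orbit (A : Matrix (Fin d) (Fin n) ℤ) (τ : Finset (Fin n)) : Set (Fin n → ℂ) :=
  Set.range fun t : Fin d → ℂˣ => torusAct A t fun j => if j ∈ τ then 1 else 0

/-- The Zariski closure of a subset of `ℂ^n`. -/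
def zariskiClosure (Z : Set (Fin n → ℂ)) : Set (Fin n → ℂ) :=
  zeroLocus ℂ (vanishingIdeal ℂ Z)

/-! ### The initial ideal with respect to a weight vector -/

/-- The `L`-symbol of `f`: the sum of the terms of `f` of maximal `L`-degree, where the monomial
`∂^u` has `L`-degree `L · u`. -/
def symbol (L : Fin n → ℚ) (f : MvPolynomial (Fin n) ℂ) : MvPolynomial (Fin n) ℂ :=
  ∑ u ∈ f.support with ∀ v ∈ f.support, Finsupp.weight L v ≤ Finsupp.weight L u,
    monomial u (coeff u f)

/-- The graded ideal `I_A^L = gr^L(I_A)`, generated by the `L`-symbols of the elements of the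
toric ideal `I_A`. -/
def gradedIdeal (A : Matrix (Fin d) (Fin n) ℤ) (L : Fin n → ℚ) :
    Ideal (MvPolynomial (Fin n) ℂ) :=
  Ideal.span (symbol L '' (toricIdeal A Finset.univ : Set (MvPolynomial (Fin n) ℂ)))

/-- The ring `S_A^L = gr^L(S_A) = R / I_A^L`. -/
abbrev GradedToricRing (A : Matrix (Fin d) (Fin n) ℤ) (L : Fin n → ℚ) : Type :=
  MvPolynomial (Fin n) ℂ ⧸ gradedIdeal A L

/-! ### The `(A, L)`-umbrella

The rational projective space `ℙ(ℚ^d × ℚ)` contains `ℚ^d` through `q ↦ (q : 1)`. For a linear form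
`h` on `ℚ^d` and `ε > 0`, the closure of the hyperplane `h = -ε` is
`H_ε = {(q : s) | h(q) + ε s = 0}`. The complement of `H_ε` is identified, as an affine space, with
the affine hyperplane `{(q, s) | h(q) + ε s = 1}` of `ℚ^d × ℚ`. -/

/-- The column `a_j` of `A` as a point of `ℚ^d`. -/
def ratCol (A : Matrix (Fin d) (Fin n) ℤ) (j : Fin n) : Fin d → ℚ :=
  fun i => (A i j : ℚ)

/-- The conditions on the choice of the hyperplane: `h(a_j) > 0` for all `j`, and
`0 < ε < |h(a_j) / L_j|` whenever `L_j ≠ 0`. -/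
structure IsHyperplaneChoice (A : Matrix (Fin d) (Fin n) ℤ) (L : Fin n → ℚ)
    (h : (Fin d → ℚ) →ₗ[ℚ] ℚ) (ε : ℚ) : Prop where
  pos : ∀ j, 0 < h (ratCol A j)
  eps_pos : 0 < ε
  eps_lt : ∀ j, L j ≠ 0 → ε < |h (ratCol A j) / L j|

/-- The point of the affine hyperplane `{(q, s) | h(q) + ε s = 1}` that represents the point of
projective space with homogeneous coordinates `p`. -/
def chart (h : (Fin d → ℚ) →ₗ[ℚ] ℚ) (ε : ℚ) (p : (Fin d → ℚ) × ℚ) : (Fin d → ℚ) × ℚ :=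
  (h p.1 + ε * p.2)⁻¹ • p

/-- The point `0 = (0 : 1)` of projective space, in the chart. -/
def originPt (h : (Fin d → ℚ) →ₗ[ℚ] ℚ) (ε : ℚ) : (Fin d → ℚ) × ℚ :=
  chart h ε (0, 1)

/-- The point `a_j^L = a_j / L_j = (a_j : L_j)` of projective space, in the chart. It lies at
infinity if `L_j = 0`. -/
def colPt (A : Matrix (Fin d) (Fin n) ℤ) (L : Fin n → ℚ) (h : (Fin d → ℚ) →ₗ[ℚ] ℚ) (ε : ℚ)
    (j : Fin n) : (Fin d → ℚ) × ℚ :=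
  chart h ε (ratCol A j, L j)

/-- The `(A, L)`-polyhedron `Δ_A^L`: the convex hull of `0, a_1^L, …, a_n^L` relative to the
hyperplane `H_ε`. -/
def polyhedron (A : Matrix (Fin d) (Fin n) ℤ) (L : Fin n → ℚ) (h : (Fin d → ℚ) →ₗ[ℚ] ℚ)
    (ε : ℚ) : Set ((Fin d → ℚ) × ℚ) :=
  convexHull ℚ (insert (originPt h ε) (Set.range (colPt A L h ε)))

/-- The `(A, L)`-umbrella `Φ_A^L`: the faces of `Δ_A^L` that do not contain `0` (among them the
empty face). A face `F` is identified with the index set `{j | a_j^L ∈ F}`. The polyhedron is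
formed with a linear form `h` and a number `ε` as in `IsHyperplaneChoice`; all choices give the
same index sets. -/
def umbrella (A : Matrix (Fin d) (Fin n) ℤ) (L : Fin n → ℚ) : Set (Finset (Fin n)) :=
  {τ | ∃ h ε, IsHyperplaneChoice A L h ε ∧ ∃ F : Set ((Fin d → ℚ) × ℚ),
    IsExposed ℚ (polyhedron A L h ε) F ∧ originPt h ε ∉ F ∧ ∀ j, j ∈ τ ↔ colPt A L h ε j ∈ F}

/-- The facets `Φ_A^{L,d-1}` of the umbrella: its elements `τ` of dimension
`dim_ℚ(ℚτ) - 1 = d - 1`. -/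
def facets (A : Matrix (Fin d) (Fin n) ℤ) (L : Fin n → ℚ) : Set (Finset (Fin n)) :=
  {τ | τ ∈ umbrella A L ∧ Module.finrank ℚ (Submodule.span ℚ (ratCol A '' (τ : Set (Fin n)))) = d}

/-- The index `[ℤ^d : ℤτ]`. -/
def latticeIndex (A : Matrix (Fin d) (Fin n) ℤ) (τ : Finset (Fin n)) : ℕ :=
  (AddSubgroup.closure (A.col '' (τ : Set (Fin n)))).index

/-! ### Multiplicity and degree -/

/-- The length of the localization of `R / I` at the prime ideal `P`. -/
def lengthAt (I P : Ideal (MvPolynomial (Fin n) ℂ)) [P.IsPrime] : ℕ∞ :=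
  Module.length (Localization.AtPrime P)
    (LocalizedModule P.primeCompl (MvPolynomial (Fin n) ℂ ⧸ I))

/-- The minimal primes `P` of `I` with `dim R / P = dim R / I`; they correspond to the irreducible
components of maximal dimension of `Spec (R / I)`. -/
def topComponents (I : Ideal (MvPolynomial (Fin n) ℂ)) : Set (PrimeSpectrum (MvPolynomial (Fin n) ℂ)) :=
  {P | P.asIdeal ∈ I.minimalPrimes ∧
    ringKrullDim (MvPolynomial (Fin n) ℂ ⧸ P.asIdeal) = ringKrullDim (MvPolynomial (Fin n) ℂ ⧸ I)}

/-- The degree of `I`: the number of irreducible components of maximal dimension of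
`Spec (R / I)`, counted with multiplicity. The sum is finite, since `R` is Noetherian. -/
def degree (I : Ideal (MvPolynomial (Fin n) ℂ)) : ℕ∞ :=
  ∑ᶠ P ∈ topComponents I, lengthAt I P.asIdeal

/-! ### Composition chains

`R` is graded by `ℤ^d` through `deg ∂_j = a_j`. -/

/-- The part of `ℤ^d`-degree `a` of the graded module `R / I`. -/
def gradedPart (A : Matrix (Fin d) (Fin n) ℤ) (I : Ideal (MvPolynomial (Fin n) ℂ))
    (a : Fin d → ℤ) : Set (MvPolynomial (Fin n) ℂ ⧸ I) :=
  Ideal.Quotient.mk I '' {f | IsWeightedHomogeneous A.col f a}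

/-- A submodule of `R / I` is `ℤ^d`-graded if it is generated by homogeneous elements. -/
def IsGraded (A : Matrix (Fin d) (Fin n) ℤ) (I : Ideal (MvPolynomial (Fin n) ℂ))
    (N : Submodule (MvPolynomial (Fin n) ℂ) (MvPolynomial (Fin n) ℂ ⧸ I)) : Prop :=
  Submodule.span (MvPolynomial (Fin n) ℂ) {x | x ∈ N ∧ ∃ a, x ∈ gradedPart A I a} = N

/-- A composition chain `0 = N_0 ⊆ N_1 ⊆ ⋯ ⊆ N_l = S_A^L` of `ℤ^d`-graded modules such that the
quotient `N_{i+1} / N_i` is isomorphic, as a graded module, to `S_{τ_i}(-u_i)` with `τ_i` in the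
umbrella and `u_i ∈ ℤ^d`. Here `S_τ = R / I_A^τ`, and the part of degree `b` of `S_τ(-u)` is the
part of degree `b - u` of `S_τ`. -/
structure IsCompositionChain (A : Matrix (Fin d) (Fin n) ℤ) (L : Fin n → ℚ) (l : ℕ)
    (N : Fin (l + 1) → Submodule (MvPolynomial (Fin n) ℂ) (GradedToricRing A L))
    (τ : Fin l → Finset (Fin n)) (u : Fin l → Fin d → ℤ) : Prop where
  bot : N 0 = ⊥
  top : N (Fin.last l) = ⊤
  graded : ∀ i, IsGraded A (gradedIdeal A L) (N i)
  le : ∀ i : Fin l, N i.castSucc ≤ N i.succ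
  mem_umbrella : ∀ i, τ i ∈ umbrella A L
  quotient : ∀ i : Fin l,
    ∃ e : (MvPolynomial (Fin n) ℂ ⧸ toricIdeal A (τ i)) ≃ₗ[MvPolynomial (Fin n) ℂ]
        (N i.succ ⧸ (N i.castSucc).submoduleOf (N i.succ)),
      ∀ a, ∀ x ∈ gradedPart A (toricIdeal A (τ i)) a,
        ∃ y : N i.succ, (y : GradedToricRing A L) ∈ gradedPart A (gradedIdeal A L) (a + u i) ∧
          e x = Submodule.Quotient.mk y

end Umbrella

end

/-!
The ideal `I_A` is spanned by differences of monomials of the same `ℤ^d`-degree. Taking symbols, the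
initial ideal `I_A^L` is spanned by the monomials `∂^u` whose exponent does not have minimal
`L`-degree in its fibre `{v | A v = A u}` and by the differences of minimal monomials in the same
fibre (`gradedIdeal_eq_fiberIdeal`). So `S_A^L` has a basis indexed by the semigroup `ℕA`, one
vector in each degree, on which the variables act by partial shifts. The ideals with quotients of
this kind are the `fiberIdeal`s of `IsStable` predicates; the toric ideals `I_A^τ` are among them.

*Chains.* Among the nonzero monomials of such a quotient, choose one whose annihilator is maximal.
This annihilator is then a toric ideal `I_A^τ`, and factoring out the monomial leads to a
`fiberIdeal` again; iterating gives a chain (`IsStable.exists_isToricFiltration`). That `τ` belongs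
to the umbrella follows from Gordan's theorem, since the umbrella consists of the `τ` for which some
linear form `w` satisfies `w (a_j) ≤ L_j` with equality exactly on `τ` (`mem_umbrella_iff`,
`isFace_of_isPrime`).

*Multiplicities.* Comparing degrees, the chain just built writes `ℕA` as a disjoint union of
translates `u_i + ℕτ_i`. For a facet `σ`, a point deep inside the cone of `σ` lies only in
translates with `τ_i = σ`, so these translates represent each class of `ℤ^d / ℤσ` exactly once
(`card_eq_latticeIndex`). On the other hand, localizing at the prime `I_A^σ` kills every quotient
`S_τ` with `τ ≠ σ` and turns `S_σ` into a field, so for any chain whatsoever the number of `i` with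
`τ_i = σ` is the length of `S_A^L` at `I_A^σ` (`IsCompositionChain.lengthAt_eq`). Therefore all
chains have the multiplicity `[ℤ^d : ℤσ]`. The prime `I_A^σ` is the vanishing ideal of the orbit by
linear independence of the characters of the torus.

*Degree.* Every prime containing `I_A^L` contains `I_A^τ` for a face `τ`, and the Krull dimension of
`R / I_A^τ` is the rank of `τ`, by Noether normalization (`ringKrullDim_toricRing`). As a facet
exists (`exists_isFace_isFull`), the components of maximal dimension are those of the facets.
-/

namespace Umbrella

variable {d n : ℕ}

/-! ### Gordan's theorem and the faces of the umbrella -/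

/-- **Gordan's theorem** over the rational numbers: either some linear form is positive on all the
given vectors, or the vectors satisfy a nontrivial linear relation with nonnegative coefficients. -/
theorem exists_dual_pos_or_relation {V : Type*} [AddCommGroup V] [Module ℚ V] (m : ℕ)
    (v : Fin m → V) :
    (∃ l : V →ₗ[ℚ] ℚ, ∀ i, 0 < l (v i)) ∨
      ∃ c : Fin m → ℚ, (∀ i, 0 ≤ c i) ∧ (∃ i, 0 < c i) ∧ ∑ i, c i • v i = 0 := by
  -- A finite family of positive numbers dominates a small positive multiple of any other family.
  have small : ∀ {m : ℕ} (p q : Fin m → ℚ), (∀ i, 0 < p i) →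
      ∃ ε : ℚ, 0 < ε ∧ ∀ i, 0 < p i + ε * q i := by
    intro m p q hp
    have h : ∀ i, ∃ ε : ℚ, 0 < ε ∧ ∀ δ, 0 < δ → δ ≤ ε → 0 < p i + δ * q i := by
      intro i
      refine ⟨p i / (|q i| + 1), by have := hp i; positivity, fun δ hδ hle => ?_⟩
      rw [le_div_iff₀ (by positivity)] at hle
      nlinarith [neg_abs_le (q i)]
    choose e he h using h
    obtain rfl | hm := Nat.eq_zero_or_pos m
    · exact ⟨1, one_pos, fun i => i.elim0⟩
    have : Nonempty (Fin m) := ⟨⟨0, hm⟩⟩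
    obtain ⟨i₀, hi₀⟩ := Finite.exists_min e
    exact ⟨e i₀, he i₀, fun i => h i _ (he i₀) (hi₀ i)⟩
  induction m with
  | zero => exact Or.inl ⟨0, fun i => i.elim0⟩
  | succ m ih =>
    rcases ih (fun i => v i.succ) with ⟨l, hl⟩ | ⟨c, hc, ⟨i, hi⟩, hs⟩
    swap
    · refine Or.inr ⟨Fin.cons 0 c, fun i => ?_, ⟨i.succ, by simpa using hi⟩, ?_⟩
      · refine Fin.cases (by simp) (fun i => by simpa using hc i) i
      · simpa [Fin.sum_univ_succ] using hs
    rcases lt_trichotomy (l (v 0)) 0 with h0 | h0 | h0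
    · -- Project along `v 0` to the kernel of `l`.
      rcases ih (fun i => v i.succ - (l (v i.succ) / l (v 0)) • v 0) with
        ⟨l', hl'⟩ | ⟨c, hc, ⟨i, hi⟩, hs⟩
      · left
        obtain ⟨ε, hε, h⟩ := small _ (fun i => l (v i.succ) / l (v 0)) hl'
        refine ⟨l' + ((ε - l' (v 0)) / l (v 0)) • l, fun i => ?_⟩
        refine Fin.cases ?_ (fun i => ?_) i
        · simp only [LinearMap.add_apply, LinearMap.smul_apply, smul_eq_mul]
          rw [div_mul_cancel₀ _ h0.ne]
          linarith
        · have := h i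
          simp only [map_sub, map_smul, smul_eq_mul] at this
          simp only [LinearMap.add_apply, LinearMap.smul_apply, smul_eq_mul]
          calc (0 : ℚ) < _ := this
            _ = _ := by field_simp; ring
      · right
        have hc0 : 0 ≤ ∑ i, -(c i * (l (v i.succ) / l (v 0))) :=
          Finset.sum_nonneg fun i _ => by
            have := mul_nonneg (hc i) (div_nonneg_of_nonpos (neg_nonpos.2 (hl i).le) h0.le)
            rw [neg_div] at this
            linarith
        refine ⟨Fin.cons (∑ i, -(c i * (l (v i.succ) / l (v 0)))) c, fun i => ?_,
          ⟨i.succ, by simpa using hi⟩, ?_⟩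
        · exact Fin.cases (by simpa using hc0) (fun i => by simpa using hc i) i
        · rw [Fin.sum_univ_succ]
          simp only [Fin.cons_zero, Fin.cons_succ]
          simp only [smul_sub, Finset.sum_sub_distrib, smul_smul] at hs
          rw [Finset.sum_neg_distrib, neg_smul, Finset.sum_smul, neg_add_eq_sub]
          exact hs
    · by_cases hv : v 0 = 0
      · refine Or.inr ⟨Fin.cons 1 0, fun i => ?_, ⟨0, by simp⟩, ?_⟩
        · exact Fin.cases (by simp) (fun i => by simp) i
        · simp [Fin.sum_univ_succ, hv]
      · obtain ⟨g, hg⟩ : ∃ g : V →ₗ[ℚ] ℚ, 0 < g (v 0) := by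
          obtain ⟨g, hg⟩ := not_forall.1 (mt (Module.forall_dual_apply_eq_zero_iff ℚ (v 0)).1 hv)
          rcases lt_or_gt_of_ne hg with h | h
          · exact ⟨-g, by simpa using h⟩
          · exact ⟨g, h⟩
        obtain ⟨ε, hε, h⟩ := small _ (fun i => g (v i.succ)) hl
        refine Or.inl ⟨l + ε • g, fun i => ?_⟩
        refine Fin.cases ?_ (fun i => ?_) i
        · simpa [h0] using mul_pos hε hg
        · simpa using h i
    · exact Or.inl ⟨l, fun i => Fin.cases h0 hl i⟩

/-- Gordan's theorem for families over a finite type. -/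
theorem exists_dual_pos_or_relation_fintype {V ι : Type*} [AddCommGroup V] [Module ℚ V]
    [Fintype ι] (v : ι → V) :
    (∃ l : V →ₗ[ℚ] ℚ, ∀ i, 0 < l (v i)) ∨
      ∃ c : ι → ℚ, (∀ i, 0 ≤ c i) ∧ (∃ i, 0 < c i) ∧ ∑ i, c i • v i = 0 := by
  let e := Fintype.equivFin ι
  rcases exists_dual_pos_or_relation _ (v ∘ e.symm) with ⟨l, hl⟩ | ⟨c, hc, ⟨i, hi⟩, hs⟩
  · exact Or.inl ⟨l, fun i => by simpa using hl (e i)⟩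
  · refine Or.inr ⟨c ∘ e, fun i => hc _, ⟨e.symm i, by simpa using hi⟩, ?_⟩
    rw [← hs, ← e.sum_comp]
    simp

/-- `IsFace A L τ` says that some linear form `w` satisfies `w (a_j) ≤ L_j` for all `j`, with
equality exactly for `j ∈ τ`. These are the elements of the umbrella, see `mem_umbrella_iff`. -/
def IsFace (A : Matrix (Fin d) (Fin n) ℤ) (L : Fin n → ℚ) (τ : Finset (Fin n)) : Prop :=
  ∃ w : (Fin d → ℚ) →ₗ[ℚ] ℚ, (∀ j ∈ τ, w (ratCol A j) = L j) ∧ ∀ j ∉ τ, w (ratCol A j) < L j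

/-- A finite family of rational numbers has a common denominator. -/
theorem exists_common_denom {ι : Type*} [Finite ι] (c : ι → ℚ) :
    ∃ m : ℕ, 0 < m ∧ ∃ z : ι → ℤ, ∀ i, (m : ℚ) * c i = z i := by
  have := Fintype.ofFinite ι
  refine ⟨∏ i, (c i).den, Finset.prod_pos fun i _ => (c i).pos, ?_⟩
  have h : ∀ i, ∃ z : ℤ, ((∏ i, (c i).den : ℕ) : ℚ) * c i = z := by
    intro i
    obtain ⟨k, hk⟩ := Finset.dvd_prod_of_mem (fun i => (c i).den) (Finset.mem_univ i)
    refine ⟨k * (c i).num, ?_⟩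
    rw [hk]
    push_cast
    rw [mul_comm ((c i).den : ℚ), mul_assoc, Rat.den_mul_eq_num]
  exact ⟨_, fun i => (h i).choose_spec⟩

theorem sum_smul_ratCol {ι : Type*} (s : Finset ι) (A : Matrix (Fin d) (Fin n) ℤ)
    (f : ι → Fin n) (z : ι → ℤ) :
    ∑ i ∈ s, (z i : ℚ) • ratCol A (f i) = fun k => ((∑ i ∈ s, z i • A.col (f i)) k : ℚ) := by
  funext k
  simp [ratCol, Finset.sum_apply]

/-- The columns of an admissible matrix lie in an open half-space. -/
theorem exists_pos_linearForm {A : Matrix (Fin d) (Fin n) ℤ} (hA : IsAdmissible A) :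
    ∃ h : (Fin d → ℚ) →ₗ[ℚ] ℚ, ∀ j, 0 < h (ratCol A j) := by
  refine (exists_dual_pos_or_relation_fintype (ratCol A)).resolve_right ?_
  rintro ⟨c, hc, ⟨i, hi⟩, hs⟩
  obtain ⟨m, hm, z, hz⟩ := exists_common_denom c
  have hz0 : ∀ j, 0 ≤ z j := fun j => by
    have : (0 : ℚ) ≤ z j := by rw [← hz]; exact mul_nonneg (by positivity) (hc j)
    exact_mod_cast this
  have hzi : 0 < z i := by
    have : (0 : ℚ) < z i := by rw [← hz]; exact mul_pos (by exact_mod_cast hm) hi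
    exact_mod_cast this
  have hsum : ∑ j, z j • A.col j = 0 := by
    have h1 : ∑ j, (z j : ℚ) • ratCol A j = 0 := by
      rw [← smul_zero (m : ℚ), ← hs, Finset.smul_sum]
      exact Finset.sum_congr rfl fun j _ => by rw [smul_smul, hz]
    rw [sum_smul_ratCol Finset.univ A (fun j => j) z] at h1
    funext k
    have h2 := congrFun h1 k
    simp only [Pi.zero_apply] at h2 ⊢
    exact_mod_cast h2
  have hmem : ∀ j, z j • A.col j ∈ AddSubmonoid.closure (Set.range A.col) := fun j => by
    lift z j to ℕ using hz0 j with k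
    rw [natCast_zsmul]
    exact AddSubmonoid.nsmul_mem _ (AddSubmonoid.subset_closure (Set.mem_range_self j)) _
  have h0 := hA.positive _ (hmem i) (by
    rw [← Finset.add_sum_erase _ _ (Finset.mem_univ i)] at hsum
    rw [neg_eq_of_add_eq_zero_right hsum]
    exact sum_mem fun j _ => hmem j)
  exact hA.col_ne_zero i ((smul_eq_zero.1 h0).resolve_left hzi.ne')

theorem exists_isHyperplaneChoice {A : Matrix (Fin d) (Fin n) ℤ} (hA : IsAdmissible A)
    (L : Fin n → ℚ) : ∃ h ε, IsHyperplaneChoice A L h ε := by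
  obtain ⟨h, hh⟩ := exists_pos_linearForm hA
  have : ∃ ε : ℚ, 0 < ε ∧ ∀ j, L j ≠ 0 → ε < |h (ratCol A j) / L j| := by
    have key : ∀ s : Finset (Fin n), ∃ ε : ℚ, 0 < ε ∧ ∀ j ∈ s, L j ≠ 0 →
        ε < |h (ratCol A j) / L j| := by
      intro s
      induction s using Finset.induction_on with
      | empty => exact ⟨1, one_pos, by simp⟩
      | insert j s _ ih =>
        obtain ⟨ε, hε, hs⟩ := ih
        by_cases hL : L j = 0
        · refine ⟨ε, hε, fun k hk hLk => ?_⟩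
          rcases Finset.mem_insert.1 hk with rfl | hk
          · exact absurd hL hLk
          · exact hs k hk hLk
        · have hp : 0 < |h (ratCol A j) / L j| := abs_pos.2 (div_ne_zero (hh j).ne' hL)
          refine ⟨min ε (|h (ratCol A j) / L j| / 2), lt_min hε (half_pos hp),
            fun k hk hLk => ?_⟩
          rcases Finset.mem_insert.1 hk with rfl | hk
          · exact (min_le_right _ _).trans_lt (half_lt_self hp)
          · exact (min_le_left _ _).trans_lt (hs k hk hLk)
    obtain ⟨ε, h1, h2⟩ := key Finset.univ
    exact ⟨ε, h1, fun j => h2 j (Finset.mem_univ j)⟩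
  obtain ⟨ε, h1, h2⟩ := this
  exact ⟨h, ε, hh, h1, h2⟩

theorem IsHyperplaneChoice.height_pos {A : Matrix (Fin d) (Fin n) ℤ} {L : Fin n → ℚ}
    {h : (Fin d → ℚ) →ₗ[ℚ] ℚ} {ε : ℚ} (H : IsHyperplaneChoice A L h ε) (j : Fin n) :
    0 < h (ratCol A j) + ε * L j := by
  by_cases hL : L j = 0
  · simpa [hL] using H.pos j
  · have h1 := H.eps_lt j hL
    have hp := H.pos j
    rw [abs_div, lt_div_iff₀ (abs_pos.2 hL), abs_of_pos hp] at h1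
    have : -(ε * |L j|) ≤ ε * L j := by
      rw [← mul_neg]; exact mul_le_mul_of_nonneg_left (neg_abs_le _) H.eps_pos.le
    linarith

/-- The elements of the umbrella are the index sets of the faces of the lower hull of the points
`(a_j, L_j)`. Dehomogenizing, a linear form that is maximal on a face of the polyhedron not
containing the origin becomes, up to a positive factor, of the form `(q, s) ↦ w q - s`. -/
theorem mem_umbrella_iff {A : Matrix (Fin d) (Fin n) ℤ} (hA : IsAdmissible A) {L : Fin n → ℚ}
    {τ : Finset (Fin n)} : τ ∈ umbrella A L ↔ IsFace A L τ := by
  constructor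
  · rintro ⟨h, ε, H, F, hF, h0, hτ⟩
    have hε := H.eps_pos
    have hc : ∀ j, colPt A L h ε j ∈ polyhedron A L h ε := fun j =>
      subset_convexHull _ _ (Set.mem_insert_of_mem _ ⟨j, rfl⟩)
    have ho : originPt h ε ∈ polyhedron A L h ε := subset_convexHull _ _ (Set.mem_insert _ _)
    by_cases hne : F.Nonempty
    · obtain ⟨l, rfl⟩ := hF hne
      obtain ⟨x₀, hx₀, hmax⟩ := hne
      set M := l x₀ with hM
      have hlt : l (originPt h ε) < M := by
        refine lt_of_le_of_ne (hmax _ ho) fun he => h0 ⟨ho, fun y hy => ?_⟩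
        rw [he]; exact hmax y hy
      have hface : ∀ j, (j ∈ τ ↔ l (colPt A L h ε j) = M) := fun j => by
        rw [hτ]
        constructor
        · rintro ⟨-, h2⟩
          exact le_antisymm (hmax _ (hc j)) (h2 _ hx₀)
        · intro he
          exact ⟨hc j, fun y hy => by rw [he]; exact hmax y hy⟩
      -- Homogenize: `M (h q + ε s) - l (q, s)` is nonnegative on the cone, and zero on the face.
      have e0 : l (originPt h ε) = ε⁻¹ * l (0, 1) := by
        rw [originPt, chart, map_smul]
        simp
      have ej : ∀ j, l (colPt A L h ε j) =
          (h (ratCol A j) + ε * L j)⁻¹ * (l (ratCol A j, 0) + L j * l (0, 1)) := fun j => by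
        have : ((ratCol A j, L j) : (Fin d → ℚ) × ℚ) = (ratCol A j, 0) + L j • (0, 1) := by
          simp
        simp only [colPt, chart, map_smul, smul_eq_mul]
        rw [this, map_add, map_smul, smul_eq_mul]
      have hD : 0 < M * ε - l (0, 1) := by
        rw [e0, inv_mul_lt_iff₀ hε] at hlt
        linarith
      refine ⟨(M * ε - l (0, 1))⁻¹ • ((l.toLinearMap ∘ₗ LinearMap.inl ℚ (Fin d → ℚ) ℚ) - M • h),
        fun j hj => ?_, fun j hj => ?_⟩
      · have h1 := (hface j).1 hj
        rw [ej, inv_mul_eq_iff_eq_mul₀ (H.height_pos j).ne'] at h1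
        simp only [LinearMap.smul_apply, LinearMap.sub_apply, LinearMap.comp_apply,
          LinearMap.inl_apply, smul_eq_mul, ContinuousLinearMap.coe_coe]
        rw [inv_mul_eq_iff_eq_mul₀ hD.ne']
        linarith
      · have h1 := lt_of_le_of_ne (hmax _ (hc j)) (mt (hface j).2 hj)
        rw [ej, inv_mul_lt_iff₀ (H.height_pos j)] at h1
        simp only [LinearMap.smul_apply, LinearMap.sub_apply, LinearMap.comp_apply,
          LinearMap.inl_apply, smul_eq_mul, ContinuousLinearMap.coe_coe]
        rw [inv_mul_lt_iff₀ hD]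
        linarith
    · -- The empty face: a large negative multiple of `h` lies strictly below `L`.
      have hτ0 : ∀ j, j ∉ τ := fun j hj => hne ⟨_, (hτ j).1 hj⟩
      refine ⟨-(ε⁻¹ • h), fun j hj => absurd hj (hτ0 j), fun j _ => ?_⟩
      have := H.height_pos j
      simp only [LinearMap.neg_apply, LinearMap.smul_apply, smul_eq_mul]
      rw [neg_lt, ← sub_pos]
      have h2 : 0 < ε⁻¹ * (h (ratCol A j) + ε * L j) := mul_pos (inv_pos.2 hε) this
      rw [mul_add, inv_mul_cancel_left₀ hε.ne'] at h2
      linarith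
  · rintro ⟨w, hw, hw'⟩
    obtain ⟨h, ε, H⟩ := exists_isHyperplaneChoice hA L
    have hε := H.eps_pos
    let l : ((Fin d → ℚ) × ℚ) →ₗ[ℚ] ℚ := w ∘ₗ LinearMap.fst ℚ _ _ - LinearMap.snd ℚ _ _
    have hcont : Continuous l := by
      have h1 : Continuous w := LinearMap.continuous_on_pi w
      change Continuous fun x : (Fin d → ℚ) × ℚ => w x.1 - x.2
      fun_prop
    have ec : ∀ j, l (colPt A L h ε j) =
        (h (ratCol A j) + ε * L j)⁻¹ * (w (ratCol A j) - L j) := fun j => by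
      simp [l, colPt, chart, mul_sub]
    have e0 : l (originPt h ε) = -ε⁻¹ := by
      simp [l, originPt, chart]
    have hle : ∀ x ∈ polyhedron A L h ε, l x ≤ 0 := by
      have hconv : Convex ℚ {x | l x ≤ 0} := convex_halfSpace_le l.isLinear 0
      refine fun x hx => (convexHull_min ?_ hconv) hx
      rintro _ (rfl | ⟨j, rfl⟩)
      · simp [e0, hε.le]
      · rw [Set.mem_ofPred_eq, ec]
        refine mul_nonpos_of_nonneg_of_nonpos (inv_nonneg.2 (H.height_pos j).le) ?_
        by_cases hj : j ∈ τ
        · simp [hw j hj]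
        · linarith [hw' j hj]
    refine ⟨h, ε, H, {x ∈ polyhedron A L h ε | l x = 0}, ?_, ?_, ?_⟩
    · rintro ⟨x₀, hx₀, hl₀⟩
      refine ⟨⟨l, hcont⟩, ?_⟩
      ext x
      refine and_congr_right fun hx => ⟨fun hlx y hy => ?_, fun hm => ?_⟩
      · change l y ≤ l x
        rw [hlx]; exact hle y hy
      · have : l x₀ ≤ l x := hm x₀ hx₀
        exact le_antisymm (hle x hx) (hl₀ ▸ this)
    · rintro ⟨-, h0⟩
      rw [e0] at h0
      simp [hε.ne'] at h0
    · intro j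
      have hmem : colPt A L h ε j ∈ polyhedron A L h ε :=
        subset_convexHull _ _ (Set.mem_insert_of_mem _ ⟨j, rfl⟩)
      rw [Set.mem_ofPred_eq, ec]
      constructor
      · intro hj
        exact ⟨hmem, by simp [hw j hj]⟩
      · rintro ⟨-, h2⟩
        by_contra hj
        rcases mul_eq_zero.1 h2 with h2 | h2
        · exact (H.height_pos j).ne' (inv_eq_zero.1 h2)
        · exact (hw' j hj).ne (sub_eq_zero.1 h2)

/-! ### Faces in terms of exponent vectors, and full-dimensional faces -/

/-- The embedding of `ℤ^d` into `ℚ^d`. -/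
def castVec (d : ℕ) : (Fin d → ℤ) →+ (Fin d → ℚ) :=
  (Int.castAddHom ℚ).compLeft (Fin d)

theorem castVec_col (A : Matrix (Fin d) (Fin n) ℤ) (j : Fin n) :
    castVec d (A.col j) = ratCol A j := rfl

theorem castVec_injective : Function.Injective (castVec d) := fun a b h => by
  funext i
  have := congrFun h i
  simpa [castVec] using this

theorem castVec_weight (A : Matrix (Fin d) (Fin n) ℤ) (u : Fin n →₀ ℕ) :
    castVec d (Finsupp.weight A.col u) = ∑ j, (u j : ℚ) • ratCol A j := by
  rw [Finsupp.weight_eq_sum, map_sum]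
  exact Finset.sum_congr rfl fun j _ => by rw [map_nsmul, castVec_col, Nat.cast_smul_eq_nsmul]

/-- The linear form of a face bounds the `L`-degree of a monomial from below by a function of its
`ℤ^d`-degree, with equality exactly for the monomials in the variables of the face. -/
theorem linearForm_weight_le {A : Matrix (Fin d) (Fin n) ℤ} {L : Fin n → ℚ} {τ : Finset (Fin n)}
    {w : (Fin d → ℚ) →ₗ[ℚ] ℚ} (hw : ∀ j ∈ τ, w (ratCol A j) = L j)
    (hw' : ∀ j ∉ τ, w (ratCol A j) < L j) (u : Fin n →₀ ℕ) :
    w (castVec d (Finsupp.weight A.col u)) ≤ Finsupp.weight L u ∧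
      (w (castVec d (Finsupp.weight A.col u)) = Finsupp.weight L u ↔ ∀ j, u j ≠ 0 → j ∈ τ) := by
  have h1 : w (castVec d (Finsupp.weight A.col u)) = ∑ j, (u j : ℚ) * w (ratCol A j) := by
    simp [castVec_weight]
  have h2 : Finsupp.weight L u = ∑ j, (u j : ℚ) * L j := by
    simp [Finsupp.weight_eq_sum]
  have hle : ∀ j ∈ Finset.univ, (u j : ℚ) * w (ratCol A j) ≤ (u j : ℚ) * L j := fun j _ => by
    refine mul_le_mul_of_nonneg_left ?_ (by positivity)
    by_cases hj : j ∈ τ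
    · exact (hw j hj).le
    · exact (hw' j hj).le
  rw [h1, h2]
  refine ⟨Finset.sum_le_sum hle, ?_⟩
  rw [Finset.sum_eq_sum_iff_of_le hle]
  refine ⟨fun h j hj => ?_, fun h j _ => ?_⟩
  · by_contra hjτ
    exact (hw' j hjτ).ne (mul_left_cancel₀ (by exact_mod_cast hj) (h j (Finset.mem_univ j)))
  · by_cases hj : u j = 0
    · simp [hj]
    · rw [hw j (h j hj)]

/-- A criterion for faces in terms of exponent vectors: it suffices that no exponent with support
in `τ` can be traded, inside its fibre, for one of at most the same `L`-degree, except for another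
exponent with support in `τ` and the same `L`-degree. -/
theorem isFace_of_forall_exponent {A : Matrix (Fin d) (Fin n) ℤ} {L : Fin n → ℚ}
    {τ : Finset (Fin n)}
    (H : ∀ u v : Fin n →₀ ℕ, (∀ j, v j ≠ 0 → j ∈ τ) →
      Finsupp.weight A.col u = Finsupp.weight A.col v → Finsupp.weight L u ≤ Finsupp.weight L v →
      Finsupp.weight L u = Finsupp.weight L v ∧ ∀ j, u j ≠ 0 → j ∈ τ) :
    IsFace A L τ := by
  classical
  let p : Fin n → (Fin d → ℚ) × ℚ := fun j => (ratCol A j, L j)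
  let S := Submodule.span ℚ (Set.range fun j : τ => p j)
  -- By Gordan's theorem modulo the span of the points of `τ`, it suffices to exclude a relation.
  rcases exists_dual_pos_or_relation_fintype
    (fun o : Option {j // j ∉ τ} => S.mkQ (o.elim (0, 1) fun j => p j)) with
    ⟨l, hl⟩ | ⟨c, hc, ⟨o, ho⟩, hs⟩
  · let l' := l ∘ₗ S.mkQ
    have h0 : 0 < l' (0, 1) := hl none
    have hj : ∀ j ∉ τ, 0 < l' (p j) := fun j hj => hl (some ⟨j, hj⟩)
    have hτ : ∀ j ∈ τ, l' (p j) = 0 := fun j hj => by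
      have : S.mkQ (p j) = 0 := by
        rw [← LinearMap.mem_ker, Submodule.ker_mkQ]
        exact Submodule.subset_span ⟨⟨j, hj⟩, rfl⟩
      simp only [l', LinearMap.comp_apply, this, map_zero]
    have hp : ∀ j, l' (p j) = l' (ratCol A j, 0) + L j * l' (0, 1) := fun j => by
      have : p j = (ratCol A j, 0) + L j • (0, 1) := by simp [p]
      rw [this, map_add, map_smul, smul_eq_mul]
    refine ⟨-((l' (0, 1))⁻¹ • (l' ∘ₗ LinearMap.inl ℚ _ _)), fun j hjτ => ?_, fun j hjτ => ?_⟩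
    · have := hτ j hjτ
      rw [hp] at this
      simp only [LinearMap.neg_apply, LinearMap.smul_apply, LinearMap.comp_apply,
        LinearMap.inl_apply, smul_eq_mul]
      rw [neg_eq_iff_eq_neg, inv_mul_eq_iff_eq_mul₀ h0.ne']
      linarith
    · have := hj j hjτ
      rw [hp] at this
      simp only [LinearMap.neg_apply, LinearMap.smul_apply, LinearMap.comp_apply,
        LinearMap.inl_apply, smul_eq_mul]
      rw [neg_lt, lt_inv_mul_iff₀ h0]
      linarith
  · exfalso
    -- Lift the relation to `ℚ^d × ℚ` and clear denominators.
    have hmem : c none • ((0, 1) : (Fin d → ℚ) × ℚ) + ∑ j : {j // j ∉ τ}, c (some j) • p j ∈ S := by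
      rw [← Submodule.ker_mkQ S, LinearMap.mem_ker, ← hs, Fintype.sum_option, map_add,
        map_smul, map_sum]
      simp only [map_smul, Option.elim]
    obtain ⟨b, hb⟩ := (Submodule.mem_span_range_iff_exists_fun ℚ).1 hmem
    let C : Option (Fin n) → ℚ := fun o => o.elim (c none) fun j =>
      if hj : j ∈ τ then -b ⟨j, hj⟩ else c (some ⟨j, hj⟩)
    have hC : C none • ((0, 1) : (Fin d → ℚ) × ℚ) + ∑ j, C (some j) • p j = 0 := by
      have e : ∑ j, C (some j) • p j =
          ∑ j : τ, (-b j) • p j + ∑ j : {j // j ∉ τ}, c (some j) • p j := by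
        rw [← Fintype.sum_subtype_add_sum_subtype (fun j => j ∈ τ)]
        congr 1
        · exact Finset.sum_congr (by ext; simp) fun j _ => by simp [C]
        · exact Fintype.sum_congr _ _ fun j => by simp [C, j.2]
      rw [e]
      simp only [neg_smul, Finset.sum_neg_distrib, hb]
      change c none • _ + _ = 0
      abel
    obtain ⟨m, hm, z, hz⟩ := exists_common_denom C
    have hm' : (0 : ℚ) < m := by exact_mod_cast hm
    have hzC : (z none : ℚ) • ((0, 1) : (Fin d → ℚ) × ℚ) + ∑ j, (z (some j) : ℚ) • p j = 0 := by
      have := congrArg (fun x => (m : ℚ) • x) hC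
      simpa only [smul_add, Finset.smul_sum, smul_smul, hz, smul_zero] using this
    have hpos : ∀ o, 0 ≤ C o → 0 ≤ z o := fun o ho => by
      have : (0 : ℚ) ≤ z o := by rw [← hz]; exact mul_nonneg hm'.le ho
      exact_mod_cast this
    have hz0 : 0 ≤ z none := hpos _ (hc none)
    have hzj : ∀ j ∉ τ, 0 ≤ z (some j) := fun j hj => hpos _ (by simpa [C, hj] using hc _)
    let u : Fin n →₀ ℕ := Finsupp.equivFunOnFinite.symm fun j => (z (some j)).toNat
    let v : Fin n →₀ ℕ := Finsupp.equivFunOnFinite.symm fun j => (-z (some j)).toNat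
    have huv : ∀ j, ((u j : ℤ) : ℚ) - ((v j : ℤ) : ℚ) = z (some j) := fun j => by
      have : (u j : ℤ) - v j = z (some j) := by simp [u, v]
      exact_mod_cast this
    have hsumL : (z none : ℚ) + ∑ j, (z (some j) : ℚ) * L j = 0 := by
      have := congrArg Prod.snd hzC
      simpa [Prod.snd_sum, p] using this
    have hsumA : ∑ j, (z (some j) : ℚ) • ratCol A j = 0 := by
      have := congrArg Prod.fst hzC
      simpa [Prod.fst_sum, p] using this
    have hL : Finsupp.weight L v = Finsupp.weight L u + z none := by
      have : Finsupp.weight L u - Finsupp.weight L v = ∑ j, (z (some j) : ℚ) * L j := by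
        simp only [Finsupp.weight_eq_sum, ← Finset.sum_sub_distrib, nsmul_eq_mul, ← huv, sub_mul,
          Int.cast_natCast]
      linarith
    have hAuv : Finsupp.weight A.col u = Finsupp.weight A.col v := by
      apply castVec_injective
      rw [← sub_eq_zero, ← hsumA, castVec_weight, castVec_weight, ← Finset.sum_sub_distrib]
      exact Finset.sum_congr rfl fun j _ => by
        rw [← huv, sub_smul, Int.cast_natCast, Int.cast_natCast]
    have hz0' : (0 : ℚ) ≤ z none := by exact_mod_cast hz0
    obtain ⟨h1, h2⟩ := H u v (fun j hj => by
      by_contra hjτ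
      have := hzj j hjτ
      simp only [v, Finsupp.equivFunOnFinite_symm_apply_apply] at hj
      omega) hAuv (by linarith)
    have hCz : ∀ o, 0 < C o → 0 < z o := fun o ho => by
      have : (0 : ℚ) < z o := by rw [← hz]; exact mul_pos hm' ho
      exact_mod_cast this
    rcases o with _ | ⟨j, hj⟩
    · have : (0 : ℚ) < z none := by exact_mod_cast hCz none ho
      linarith
    · have : 0 < z (some j) := hCz (some j) (by simpa [C, hj] using ho)
      exact hj (h2 j (by simp only [u, Finsupp.equivFunOnFinite_symm_apply_apply]; omega))

/-- A face is full-dimensional if its columns span `ℚ^d`. -/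
def IsFull (A : Matrix (Fin d) (Fin n) ℤ) (τ : Finset (Fin n)) : Prop :=
  Submodule.span ℚ (ratCol A '' (τ : Set (Fin n))) = ⊤

theorem isFull_iff_finrank {A : Matrix (Fin d) (Fin n) ℤ} {τ : Finset (Fin n)} :
    IsFull A τ ↔ Module.finrank ℚ (Submodule.span ℚ (ratCol A '' (τ : Set (Fin n)))) = d := by
  unfold IsFull
  refine ⟨fun h => by rw [h]; simp, fun h => Submodule.eq_top_of_finrank_eq (by simpa using h)⟩

theorem mem_facets_iff {A : Matrix (Fin d) (Fin n) ℤ} (hA : IsAdmissible A) {L : Fin n → ℚ}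
    {τ : Finset (Fin n)} : τ ∈ facets A L ↔ IsFace A L τ ∧ IsFull A τ := by
  rw [isFull_iff_finrank, ← mem_umbrella_iff hA]
  rfl

theorem span_ratCol_eq_top {A : Matrix (Fin d) (Fin n) ℤ} (hA : IsAdmissible A) :
    Submodule.span ℚ (Set.range (ratCol A)) = ⊤ := by
  have h : ∀ x : Fin d → ℤ, castVec d x ∈ Submodule.span ℚ (Set.range (ratCol A)) := by
    intro x
    have hx : x ∈ AddSubgroup.closure (Set.range A.col) := by rw [hA.span_eq_top]; trivial
    induction hx using AddSubgroup.closure_induction with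
    | mem x hx =>
      obtain ⟨j, rfl⟩ := hx
      exact Submodule.subset_span ⟨j, rfl⟩
    | zero => simp
    | add x y _ _ hx hy => rw [map_add]; exact add_mem hx hy
    | neg x _ hx => rw [map_neg]; exact neg_mem hx
  rw [eq_top_iff]
  intro x _
  obtain ⟨m, hm, z, hz⟩ := exists_common_denom x
  have hm' : (m : ℚ) ≠ 0 := by exact_mod_cast hm.ne'
  have : x = (m : ℚ)⁻¹ • castVec d z := by
    funext i
    simp [castVec, ← hz, hm']
  rw [this]
  exact Submodule.smul_mem _ _ (h z)

/-- Two linear forms that agree with `L` on a full-dimensional face agree; hence such a face is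
not properly contained in another face. -/
theorem IsFull.eq_of_subset {A : Matrix (Fin d) (Fin n) ℤ} {L : Fin n → ℚ}
    {σ τ : Finset (Fin n)} (hfull : IsFull A σ) (hσ : IsFace A L σ) (hτ : IsFace A L τ)
    (hsub : σ ⊆ τ) : σ = τ := by
  obtain ⟨w, hw, hw'⟩ := hσ
  obtain ⟨x, hx, hx'⟩ := hτ
  have : w = x := by
    refine LinearMap.ext_on hfull ?_
    rintro _ ⟨j, hj, rfl⟩
    rw [hw j hj, hx j (hsub hj)]
  subst this
  refine Finset.Subset.antisymm hsub fun j hj => ?_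
  by_contra hjσ
  exact (hw' j hjσ).ne (hx j hj)

/-- A face with a maximal number of elements is full-dimensional: otherwise its linear form can be
moved in a direction that is constant on the face until a further column becomes tight. -/
theorem exists_isFace_isFull {A : Matrix (Fin d) (Fin n) ℤ} (hA : IsAdmissible A)
    (L : Fin n → ℚ) : ∃ σ, IsFace A L σ ∧ IsFull A σ := by
  classical
  have hne : ({τ | IsFace A L τ} : Set (Finset (Fin n))).Nonempty := by
    obtain ⟨h, ε, H⟩ := exists_isHyperplaneChoice hA L
    refine ⟨∅, -(ε⁻¹ • h), by simp, fun j _ => ?_⟩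
    have := H.height_pos j
    simp only [LinearMap.neg_apply, LinearMap.smul_apply, smul_eq_mul]
    have h2 : 0 < ε⁻¹ * (h (ratCol A j) + ε * L j) := mul_pos (inv_pos.2 H.eps_pos) this
    rw [mul_add, inv_mul_cancel_left₀ H.eps_pos.ne'] at h2
    linarith
  obtain ⟨σ, hσ, hmax⟩ := Set.exists_max_image _ Finset.card (Set.toFinite _) hne
  refine ⟨σ, hσ, ?_⟩
  by_contra hfull
  obtain ⟨w, hw, hw'⟩ := hσ
  obtain ⟨g, hg0, hg⟩ := Submodule.exists_le_ker_of_lt_top _ (lt_top_iff_ne_top.2 hfull)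
  have hgσ : ∀ j ∈ σ, g (ratCol A j) = 0 := fun j hj => hg (Submodule.subset_span ⟨j, hj, rfl⟩)
  obtain ⟨g, hgσ, j₀, hj₀⟩ : ∃ g : (Fin d → ℚ) →ₗ[ℚ] ℚ, (∀ j ∈ σ, g (ratCol A j) = 0) ∧
      ∃ j, 0 < g (ratCol A j) := by
    by_contra hcon
    push Not at hcon
    refine hg0 (LinearMap.ext_on (span_ratCol_eq_top hA) ?_)
    rintro _ ⟨j, rfl⟩
    have h1 := hcon g hgσ j
    have h2 := hcon (-g) (fun j hj => by simp [hgσ j hj]) j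
    simp only [LinearMap.neg_apply] at h2
    simp only [LinearMap.zero_apply]
    linarith
  obtain ⟨j₁, hj₁, hmin⟩ := Finset.exists_min_image
    (Finset.univ.filter fun j => 0 < g (ratCol A j))
    (fun j => (L j - w (ratCol A j)) / g (ratCol A j)) ⟨j₀, by simpa using hj₀⟩
  replace hj₁ : 0 < g (ratCol A j₁) := by simpa using hj₁
  have hj₁σ : j₁ ∉ σ := fun h => hj₁.ne' (hgσ _ h)
  set t := (L j₁ - w (ratCol A j₁)) / g (ratCol A j₁) with ht
  have ht0 : 0 < t := div_pos (sub_pos.2 (hw' _ hj₁σ)) hj₁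
  have hle : ∀ j, (w + t • g) (ratCol A j) ≤ L j := fun j => by
    simp only [LinearMap.add_apply, LinearMap.smul_apply, smul_eq_mul]
    by_cases hjg : 0 < g (ratCol A j)
    · have := hmin j (by simpa using hjg)
      rw [le_div_iff₀ hjg] at this
      linarith
    · have h1 : w (ratCol A j) ≤ L j := by
        by_cases hj : j ∈ σ
        · exact (hw j hj).le
        · exact (hw' j hj).le
      have := mul_nonpos_of_nonneg_of_nonpos ht0.le (not_lt.1 hjg)
      linarith
  have hface : IsFace A L (Finset.univ.filter fun j => (w + t • g) (ratCol A j) = L j) :=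
    ⟨w + t • g, fun j hj => (Finset.mem_filter.1 hj).2,
      fun j hj => lt_of_le_of_ne (hle j) fun h => hj (by simpa using h)⟩
  have hlt := Finset.card_lt_card (Finset.ssubset_iff_of_subset (s₁ := σ)
    (s₂ := Finset.univ.filter fun j => (w + t • g) (ratCol A j) = L j) (fun j hj => by
    simp [hw j hj, hgσ j hj]) |>.2 ⟨j₁, by simp [ht, div_mul_cancel₀ _ hj₁.ne'], hj₁σ⟩)
  exact absurd (hmax _ hface) (not_le.2 hlt)

/-- The lattice spanned by a full-dimensional face has finite exponent in `ℤ^d`. -/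
theorem IsFull.exists_nsmul_mem {A : Matrix (Fin d) (Fin n) ℤ} {σ : Finset (Fin n)}
    (hfull : IsFull A σ) (c : Fin d → ℤ) :
    ∃ m : ℕ, 0 < m ∧ m • c ∈ AddSubgroup.closure (A.col '' (σ : Set (Fin n))) := by
  have hc : castVec d c ∈ Submodule.span ℚ (Set.range fun j : σ => ratCol A j) := by
    have : (Set.range fun j : σ => ratCol A j) = ratCol A '' (σ : Set (Fin n)) := by
      ext x; simp
    rw [this, hfull]; trivial
  obtain ⟨b, hb⟩ := (Submodule.mem_span_range_iff_exists_fun ℚ).1 hc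
  obtain ⟨m, hm, z, hz⟩ := exists_common_denom b
  refine ⟨m, hm, ?_⟩
  have : m • c = ∑ j, z j • A.col j := by
    apply castVec_injective
    rw [map_nsmul, ← hb, map_sum, ← Nat.cast_smul_eq_nsmul ℚ, Finset.smul_sum]
    exact Finset.sum_congr rfl fun j _ => by
      rw [smul_smul, hz, map_zsmul, castVec_col, Int.cast_smul_eq_zsmul]
  rw [this]
  exact sum_mem fun j _ => zsmul_mem (AddSubgroup.subset_closure (Set.mem_image_of_mem _ j.2)) _

/-! ### Ideals whose quotient has at most one monomial in each degree -/

/-- The ideal generated by the monomials `∂^u` with `¬ P u` and by the differences `∂^u - ∂^v` of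
monomials of the same `ℤ^d`-degree for which `P` holds. -/
noncomputable def fiberIdeal (A : Matrix (Fin d) (Fin n) ℤ) (P : (Fin n →₀ ℕ) → Prop) :
    Ideal (MvPolynomial (Fin n) ℂ) :=
  Ideal.span {f | (∃ u, ¬ P u ∧ f = monomial u 1) ∨ ∃ u v, P u ∧ P v ∧
    Finsupp.weight A.col u = Finsupp.weight A.col v ∧ f = monomial u 1 - monomial v 1}

/-- The conditions on `P` under which the monomials `∂^u` with `P u` stay nonzero modulo
`fiberIdeal A P`. -/
structure IsStable (A : Matrix (Fin d) (Fin n) ℤ) (P : (Fin n →₀ ℕ) → Prop) : Prop where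
  of_add : ∀ {u v}, P (u + v) → P u
  add_congr : ∀ {u v w}, Finsupp.weight A.col u = Finsupp.weight A.col v → P u → P v →
    P (u + w) → P (v + w)

theorem monomial_mem_fiberIdeal {A : Matrix (Fin d) (Fin n) ℤ} {P : (Fin n →₀ ℕ) → Prop}
    {u : Fin n →₀ ℕ} (hu : ¬ P u) : monomial u 1 ∈ fiberIdeal A P :=
  Ideal.subset_span (Or.inl ⟨u, hu, rfl⟩)

theorem sub_mem_fiberIdeal {A : Matrix (Fin d) (Fin n) ℤ} {P : (Fin n →₀ ℕ) → Prop}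
    {u v : Fin n →₀ ℕ} (hu : P u) (hv : P v)
    (huv : Finsupp.weight A.col u = Finsupp.weight A.col v) :
    monomial u 1 - monomial v 1 ∈ fiberIdeal A P :=
  Ideal.subset_span (Or.inr ⟨u, v, hu, hv, huv, rfl⟩)

theorem fiberIdeal_le {A : Matrix (Fin d) (Fin n) ℤ} {P : (Fin n →₀ ℕ) → Prop}
    {I : Ideal (MvPolynomial (Fin n) ℂ)} (h1 : ∀ u, ¬ P u → monomial u 1 ∈ I)
    (h2 : ∀ u v, P u → P v → Finsupp.weight A.col u = Finsupp.weight A.col v →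
      monomial u 1 - monomial v 1 ∈ I) : fiberIdeal A P ≤ I := by
  refine Ideal.span_le.2 ?_
  rintro _ (⟨u, hu, rfl⟩ | ⟨u, v, hu, hv, huv, rfl⟩)
  · exact h1 u hu
  · exact h2 u v hu hv huv

open scoped Classical in
/-- The linear map that sends `∂^u` to the basis vector of its degree if `P u`, and to zero
otherwise. Its kernel is `fiberIdeal A P`, see `mem_fiberIdeal_iff`. -/
noncomputable def degMap (A : Matrix (Fin d) (Fin n) ℤ) (P : (Fin n →₀ ℕ) → Prop) :
    MvPolynomial (Fin n) ℂ →ₗ[ℂ] (Fin d → ℤ) →₀ ℂ :=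
  (basisMonomials (Fin n) ℂ).constr ℂ fun u =>
    if P u then Finsupp.single (Finsupp.weight A.col u) 1 else 0

open scoped Classical in
theorem degMap_monomial (A : Matrix (Fin d) (Fin n) ℤ) (P : (Fin n →₀ ℕ) → Prop)
    (u : Fin n →₀ ℕ) (c : ℂ) : degMap A P (monomial u c) =
      if P u then Finsupp.single (Finsupp.weight A.col u) c else 0 := by
  have h := (basisMonomials (Fin n) ℂ).constr_basis ℂ (fun u =>
    if P u then Finsupp.single (Finsupp.weight A.col u) (1 : ℂ) else 0) u
  rw [coe_basisMonomials] at h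
  have hc : (monomial u c : MvPolynomial (Fin n) ℂ) = c • monomial u 1 := by
    rw [smul_monomial, smul_eq_mul, mul_one]
  rw [hc, map_smul]
  refine (congrArg (c • ·) h).trans ?_
  simp

theorem degMap_monomial_of_pos (A : Matrix (Fin d) (Fin n) ℤ) {P : (Fin n →₀ ℕ) → Prop}
    {u : Fin n →₀ ℕ} (hu : P u) (c : ℂ) :
    degMap A P (monomial u c) = Finsupp.single (Finsupp.weight A.col u) c := by
  classical rw [degMap_monomial, if_pos hu]

theorem degMap_monomial_of_neg (A : Matrix (Fin d) (Fin n) ℤ) {P : (Fin n →₀ ℕ) → Prop}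
    {u : Fin n →₀ ℕ} (hu : ¬ P u) (c : ℂ) : degMap A P (monomial u c) = 0 := by
  classical rw [degMap_monomial, if_neg hu]

/-- Modulo the kernel of `degMap`, multiplication by a monomial is a partial shift of degrees. -/
theorem IsStable.degMap_mul_eq_zero {A : Matrix (Fin d) (Fin n) ℤ} {P : (Fin n →₀ ℕ) → Prop}
    (hP : IsStable A P) {f : MvPolynomial (Fin n) ℂ} (hf : degMap A P f = 0)
    (g : MvPolynomial (Fin n) ℂ) : degMap A P (g * f) = 0 := by
  classical
  induction g using MvPolynomial.induction_on' with
  | add p q hp hq => rw [add_mul, map_add, hp, hq, add_zero]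
  | monomial w c =>
    let T : ((Fin d → ℤ) →₀ ℂ) →ₗ[ℂ] (Fin d → ℤ) →₀ ℂ := Finsupp.lsum ℂ fun a =>
      if ∃ u, P u ∧ Finsupp.weight A.col u = a ∧ P (u + w) then
        c • Finsupp.lsingle (Finsupp.weight A.col w + a) else 0
    have hT : ∀ (a : Fin d → ℤ) (b : ℂ), T (Finsupp.single a b) =
        if ∃ u, P u ∧ Finsupp.weight A.col u = a ∧ P (u + w) then
          Finsupp.single (Finsupp.weight A.col w + a) (c * b) else 0 := by
      intro a b
      simp only [T, Finsupp.lsum_single]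
      split_ifs <;> simp
    have key : degMap A P ∘ₗ LinearMap.mulLeft ℂ (monomial w c) = T ∘ₗ degMap A P := by
      refine MvPolynomial.linearMap_ext fun u => LinearMap.ext fun b => ?_
      simp only [LinearMap.comp_apply, LinearMap.mulLeft_apply, monomial_mul]
      by_cases hu : P u
      · rw [degMap_monomial_of_pos A hu, hT]
        by_cases huw : P (w + u)
        · rw [degMap_monomial_of_pos A huw, map_add, if_pos ⟨u, hu, rfl, add_comm w u ▸ huw⟩]
        · rw [degMap_monomial_of_neg A huw, if_neg]
          rintro ⟨v, hv, hvu, hvw⟩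
          exact huw (add_comm u w ▸ hP.add_congr hvu hv hu hvw)
      · rw [degMap_monomial_of_neg A hu, map_zero, degMap_monomial_of_neg]
        intro h
        exact hu (hP.of_add (add_comm w u ▸ h))
    have := LinearMap.congr_fun key f
    simpa [hf] using this

/-- Modulo `fiberIdeal A P`, a polynomial is determined by its image under `degMap`. -/
theorem mem_fiberIdeal_of_degMap_eq_zero {A : Matrix (Fin d) (Fin n) ℤ}
    {P : (Fin n →₀ ℕ) → Prop} {f : MvPolynomial (Fin n) ℂ} (hf : degMap A P f = 0) :
    f ∈ fiberIdeal A P := by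
  classical
  let ψ : ((Fin d → ℤ) →₀ ℂ) →ₗ[ℂ] MvPolynomial (Fin n) ℂ ⧸ fiberIdeal A P :=
    Finsupp.lsum ℂ fun a => if h : ∃ u, P u ∧ Finsupp.weight A.col u = a then
      (Ideal.Quotient.mkₐ ℂ (fiberIdeal A P)).toLinearMap ∘ₗ monomial h.choose else 0
  have key : ψ ∘ₗ degMap A P = (Ideal.Quotient.mkₐ ℂ (fiberIdeal A P)).toLinearMap := by
    refine MvPolynomial.linearMap_ext fun u => LinearMap.ext fun b => ?_
    simp only [LinearMap.comp_apply, AlgHom.toLinearMap_apply, Ideal.Quotient.mkₐ_eq_mk]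
    have hb : ∀ v, (monomial v b : MvPolynomial (Fin n) ℂ) = C b * monomial v 1 := fun v => by
      rw [C_mul_monomial, mul_one]
    by_cases hu : P u
    · have h : ∃ v, P v ∧ Finsupp.weight A.col v = Finsupp.weight A.col u := ⟨u, hu, rfl⟩
      rw [degMap_monomial_of_pos A hu]
      simp only [ψ, Finsupp.lsum_single, dif_pos h, LinearMap.comp_apply,
        AlgHom.toLinearMap_apply, Ideal.Quotient.mkₐ_eq_mk]
      rw [Ideal.Quotient.eq, hb, hb u, ← mul_sub]
      exact Ideal.mul_mem_left _ _ (sub_mem_fiberIdeal h.choose_spec.1 hu h.choose_spec.2)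
    · rw [degMap_monomial_of_neg A hu, map_zero, eq_comm, Ideal.Quotient.eq_zero_iff_mem, hb]
      exact Ideal.mul_mem_left _ _ (monomial_mem_fiberIdeal hu)
  have := LinearMap.congr_fun key f
  simp only [LinearMap.comp_apply, hf, map_zero, AlgHom.toLinearMap_apply,
    Ideal.Quotient.mkₐ_eq_mk] at this
  exact Ideal.Quotient.eq_zero_iff_mem.1 this.symm

theorem IsStable.mem_fiberIdeal_iff {A : Matrix (Fin d) (Fin n) ℤ} {P : (Fin n →₀ ℕ) → Prop}
    (hP : IsStable A P) {f : MvPolynomial (Fin n) ℂ} :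
    f ∈ fiberIdeal A P ↔ degMap A P f = 0 := by
  refine ⟨fun hf => ?_, mem_fiberIdeal_of_degMap_eq_zero⟩
  refine Submodule.span_induction ?_ (map_zero _) (fun x y _ _ hx hy => ?_)
    (fun a x _ hx => hP.degMap_mul_eq_zero hx a) hf
  · rintro _ (⟨u, hu, rfl⟩ | ⟨u, v, hu, hv, huv, rfl⟩)
    · exact degMap_monomial_of_neg A hu 1
    · rw [map_sub, degMap_monomial_of_pos A hu, degMap_monomial_of_pos A hv, huv, sub_self]
  · rw [map_add, hx, hy, add_zero]

theorem IsStable.monomial_mem_iff {A : Matrix (Fin d) (Fin n) ℤ} {P : (Fin n →₀ ℕ) → Prop}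
    (hP : IsStable A P) {u : Fin n →₀ ℕ} : monomial u 1 ∈ fiberIdeal A P ↔ ¬ P u := by
  refine ⟨fun h hu => ?_, monomial_mem_fiberIdeal⟩
  rw [hP.mem_fiberIdeal_iff, degMap_monomial_of_pos A hu] at h
  simp at h

/-! ### Toric ideals -/

theorem isStable_support (A : Matrix (Fin d) (Fin n) ℤ) (τ : Finset (Fin n)) :
    IsStable A fun u => ∀ j, u j ≠ 0 → j ∈ τ where
  of_add := fun h j hj => h j (by simp [hj])
  add_congr := fun {u v w} _ _ hv h j hj => by
    by_cases hvj : v j = 0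
    · exact h j (by simp only [Finsupp.add_apply] at hj ⊢; omega)
    · exact hv j hvj

theorem prod_X_pow_eq_monomial_symm (f : Fin n → ℕ) :
    ∏ j, (X j : MvPolynomial (Fin n) ℂ) ^ f j = monomial (Finsupp.equivFunOnFinite.symm f) 1 := by
  rw [monomial_eq, C_1, one_mul, Finsupp.prod_fintype _ _ (by simp)]
  simp

theorem weight_sub_weight (A : Matrix (Fin d) (Fin n) ℤ) (f g : Fin n →₀ ℕ) :
    Finsupp.weight A.col f - Finsupp.weight A.col g =
      A.mulVec fun j => (f j : ℤ) - (g j : ℤ) := by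
  funext i
  simp only [Finsupp.weight_eq_sum, Pi.sub_apply, Finset.sum_apply, Matrix.mulVec, dotProduct,
    ← Finset.sum_sub_distrib]
  refine Finset.sum_congr rfl fun j _ => ?_
  simp only [Pi.smul_apply, Matrix.col_apply, nsmul_eq_mul]
  ring

theorem toricIdeal_eq_fiberIdeal (A : Matrix (Fin d) (Fin n) ℤ) (τ : Finset (Fin n)) :
    toricIdeal A τ = fiberIdeal A fun u => ∀ j, u j ≠ 0 → j ∈ τ := by
  apply le_antisymm
  · refine sup_le (Ideal.span_le.2 ?_) (Ideal.span_le.2 ?_)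
    · rintro _ ⟨u, hu, huτ, rfl⟩
      unfold box
      rw [prod_X_pow_eq_monomial_symm, prod_X_pow_eq_monomial_symm]
      refine sub_mem_fiberIdeal (fun j hj => ?_) (fun j hj => ?_) ?_
      · by_contra h; simp [huτ j h] at hj
      · by_contra h; simp [huτ j h] at hj
      · rw [← sub_eq_zero, weight_sub_weight, ← hu]
        congr 1
        funext j
        simp
    · rintro _ ⟨j, hj, rfl⟩
      exact monomial_mem_fiberIdeal fun h => hj (h j (by simp))
  · refine fiberIdeal_le (fun u hu => ?_) fun u v hu hv huv => ?_
    · push Not at hu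
      obtain ⟨j, hj, hjτ⟩ := hu
      have : (monomial u 1 : MvPolynomial (Fin n) ℂ) =
          monomial (u - Finsupp.single j 1) 1 * X j := by
        rw [X, monomial_mul, one_mul, tsub_add_cancel_of_le]
        exact Finsupp.single_le_iff.2 (Nat.one_le_iff_ne_zero.2 hj)
      rw [this]
      exact Ideal.mul_mem_left _ _ (Ideal.mem_sup_right (Ideal.subset_span ⟨j, hjτ, rfl⟩))
    · -- factor out the greatest common divisor of the two monomials
      have : (monomial u 1 - monomial v 1 : MvPolynomial (Fin n) ℂ) =
          monomial (u ⊓ v) 1 * box fun j => (u j : ℤ) - v j := by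
        unfold box
        rw [prod_X_pow_eq_monomial_symm, prod_X_pow_eq_monomial_symm, mul_sub, monomial_mul,
          monomial_mul, one_mul]
        congr 3
        · ext j; simp; omega
        · ext j; simp; omega
      rw [this]
      refine Ideal.mul_mem_left _ _ (Ideal.mem_sup_left (Ideal.subset_span ⟨_, ?_, ?_, rfl⟩))
      · rw [← weight_sub_weight, huv, sub_self]
      · intro j hj
        have h1 : u j = 0 := by by_contra h; exact hj (hu j h)
        have h2 : v j = 0 := by by_contra h; exact hj (hv j h)
        simp [h1, h2]

theorem mem_toricIdeal_iff {A : Matrix (Fin d) (Fin n) ℤ} {τ : Finset (Fin n)}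
    {f : MvPolynomial (Fin n) ℂ} :
    f ∈ toricIdeal A τ ↔ degMap A (fun u => ∀ j, u j ≠ 0 → j ∈ τ) f = 0 := by
  rw [toricIdeal_eq_fiberIdeal, (isStable_support A τ).mem_fiberIdeal_iff]

theorem monomial_mem_toricIdeal_iff {A : Matrix (Fin d) (Fin n) ℤ} {τ : Finset (Fin n)}
    {u : Fin n →₀ ℕ} : monomial u 1 ∈ toricIdeal A τ ↔ ¬ ∀ j, u j ≠ 0 → j ∈ τ := by
  rw [toricIdeal_eq_fiberIdeal, (isStable_support A τ).monomial_mem_iff]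

theorem X_mem_toricIdeal_iff {A : Matrix (Fin d) (Fin n) ℤ} {τ : Finset (Fin n)} {j : Fin n} :
    X j ∈ toricIdeal A τ ↔ j ∉ τ := by
  rw [X, monomial_mem_toricIdeal_iff, not_iff_not]
  simp [Finsupp.single_apply]

theorem toricIdeal_injective (A : Matrix (Fin d) (Fin n) ℤ) :
    Function.Injective (toricIdeal A) := fun σ τ h => by
  ext j
  rw [← not_iff_not, ← X_mem_toricIdeal_iff (A := A), h, X_mem_toricIdeal_iff]

theorem subset_of_toricIdeal_le {A : Matrix (Fin d) (Fin n) ℤ} {σ τ : Finset (Fin n)}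
    (h : toricIdeal A τ ≤ toricIdeal A σ) : σ ⊆ τ := fun j hj => by
  by_contra hjτ
  exact X_mem_toricIdeal_iff.1 (h (X_mem_toricIdeal_iff.2 hjτ)) hj

/-- The monomial parametrization `∂_j ↦ t^{a_j}` for `j ∈ τ`, `∂_j ↦ 0` for `j ∉ τ`, with values in
Laurent polynomials; its kernel is the toric ideal. -/
noncomputable def toricParam (A : Matrix (Fin d) (Fin n) ℤ) (τ : Finset (Fin n)) :
    MvPolynomial (Fin n) ℂ →ₐ[ℂ] AddMonoidAlgebra ℂ (Fin d → ℤ) :=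
  aeval fun j => if j ∈ τ then AddMonoidAlgebra.single (A.col j) 1 else 0

theorem toricParam_monomial (A : Matrix (Fin d) (Fin n) ℤ) (τ : Finset (Fin n))
    (u : Fin n →₀ ℕ) (c : ℂ) : (toricParam A τ (monomial u c)).coeff =
      degMap A (fun u => ∀ j, u j ≠ 0 → j ∈ τ) (monomial u c) := by
  rw [toricParam, aeval_monomial]
  by_cases hu : ∀ j, u j ≠ 0 → j ∈ τ
  · rw [degMap_monomial_of_pos A hu]
    have h1 : ∀ s : Finset (Fin n), ∏ j ∈ s,
        (AddMonoidAlgebra.single (A.col j) (1 : ℂ)) ^ u j =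
          AddMonoidAlgebra.single (∑ j ∈ s, u j • A.col j) 1 := fun s => by
      classical
      induction s using Finset.induction_on with
      | empty => simp [AddMonoidAlgebra.one_def]
      | insert j s hj ih =>
        rw [Finset.prod_insert hj, Finset.sum_insert hj, ih, AddMonoidAlgebra.single_pow,
          AddMonoidAlgebra.single_mul_single]
        simp
    have h2 : (u.prod fun i k => (if i ∈ τ then AddMonoidAlgebra.single (A.col i) (1 : ℂ)
        else 0) ^ k) = AddMonoidAlgebra.single (Finsupp.weight A.col u) 1 := by
      rw [Finsupp.prod, Finsupp.weight_apply, Finsupp.sum, ← h1]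
      exact Finset.prod_congr rfl fun j hj => by
        rw [if_pos (hu j (Finsupp.mem_support_iff.1 hj))]
    rw [h2, ← Algebra.smul_def, AddMonoidAlgebra.smul_single]
    simp
  · rw [degMap_monomial_of_neg A hu]
    push Not at hu
    obtain ⟨j, hj, hjτ⟩ := hu
    rw [Finsupp.prod, Finset.prod_eq_zero (Finsupp.mem_support_iff.2 hj), mul_zero]
    · simp
    · rw [if_neg hjτ, zero_pow hj]

theorem coeff_toricParam (A : Matrix (Fin d) (Fin n) ℤ) (τ : Finset (Fin n))
    (f : MvPolynomial (Fin n) ℂ) : (toricParam A τ f).coeff =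
      degMap A (fun u => ∀ j, u j ≠ 0 → j ∈ τ) f := by
  induction f using MvPolynomial.induction_on' with
  | monomial u c => exact toricParam_monomial A τ u c
  | add p q hp hq => rw [map_add, map_add, AddMonoidAlgebra.coeff_add, hp, hq]

theorem toricIdeal_eq_ker (A : Matrix (Fin d) (Fin n) ℤ) (τ : Finset (Fin n)) :
    toricIdeal A τ = RingHom.ker (toricParam A τ) := by
  ext f
  rw [mem_toricIdeal_iff, RingHom.mem_ker, ← coeff_toricParam, AddMonoidAlgebra.coeff_eq_zero]

theorem toricIdeal_isPrime (A : Matrix (Fin d) (Fin n) ℤ) (τ : Finset (Fin n)) :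
    (toricIdeal A τ).IsPrime := by
  rw [toricIdeal_eq_ker]
  exact RingHom.ker_isPrime _

/-- Laurent polynomials vanish on the torus only if they are zero, by linear independence of
characters; hence the toric ideal is the vanishing ideal of the orbit. -/
theorem vanishingIdeal_zariskiClosure_orbit (A : Matrix (Fin d) (Fin n) ℤ)
    (τ : Finset (Fin n)) :
    vanishingIdeal ℂ (zariskiClosure (orbit A τ)) = toricIdeal A τ := by
  have hcl : vanishingIdeal ℂ (zariskiClosure (orbit A τ)) = vanishingIdeal ℂ (orbit A τ) :=
    (zeroLocus_vanishingIdeal_galoisConnection (k := ℂ) (K := ℂ)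
      (σ := Fin n)).u_l_u_eq_u (orbit A τ)
  let χ : (Fin d → ℤ) → ((Fin d → ℂˣ) →* ℂ) := fun a =>
    (Units.coeHom ℂ).comp
      { toFun := fun t => ∏ i, t i ^ a i
        map_one' := by simp
        map_mul' := fun s t => by simp [mul_zpow, Finset.prod_mul_distrib] }
  have hχ : ∀ a t, χ a t = ((∏ i, t i ^ a i : ℂˣ) : ℂ) := fun a t => rfl
  have hinj : Function.Injective χ := by
    intro a b hab
    funext i
    have h := DFunLike.congr_fun hab (Pi.mulSingle i (Units.mk0 2 two_ne_zero))
    have h1 : ∀ a : Fin d → ℤ, χ a (Pi.mulSingle i (Units.mk0 2 two_ne_zero)) = (2 : ℂ) ^ a i := by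
      intro a
      rw [hχ, Finset.prod_eq_single i]
      · simp
      · intro k _ hk
        rw [Pi.mulSingle_eq_of_ne hk, one_zpow]
      · simp
    rw [h1, h1] at h
    have h2 := congrArg (fun z : ℂ => ‖z‖) h
    simp only [norm_zpow, Complex.norm_ofNat] at h2
    exact zpow_right_injective₀ (by norm_num) (by norm_num) h2
  have hli : LinearIndependent ℂ fun a => (χ a : (Fin d → ℂˣ) → ℂ) :=
    (linearIndependent_monoidHom (Fin d → ℂˣ) ℂ).comp χ hinj
  let E : ((Fin d → ℤ) →₀ ℂ) →ₗ[ℂ] (Fin d → ℂˣ) → ℂ :=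
    Finsupp.linearCombination ℂ fun a => (χ a : (Fin d → ℂˣ) → ℂ)
  have hE : ∀ (f : MvPolynomial (Fin n) ℂ) (t : Fin d → ℂˣ),
      aeval (torusAct A t fun j => if j ∈ τ then 1 else 0) f =
        E (degMap A (fun u => ∀ j, u j ≠ 0 → j ∈ τ) f) t := by
    intro f t
    induction f using MvPolynomial.induction_on' with
    | add p q hp hq => rw [map_add, hp, hq, map_add, map_add, Pi.add_apply]
    | monomial u c =>
      rw [aeval_monomial]
      by_cases hu : ∀ j, u j ≠ 0 → j ∈ τ
      · rw [degMap_monomial_of_pos A hu]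
        simp only [E, Finsupp.linearCombination_single, Pi.smul_apply, smul_eq_mul,
          Algebra.algebraMap_self, RingHom.id_apply]
        congr 1
        have h1 : χ (Finsupp.weight A.col u) t = ∏ j, χ (A.col j) t ^ u j := by
          have hadd : ∀ a b, χ (a + b) t = χ a t * χ b t := fun a b => by
            simp [hχ, zpow_add, Finset.prod_mul_distrib]
          have h0 : χ 0 t = 1 := by simp [hχ]
          have hn : ∀ a (k : ℕ), χ (k • a) t = χ a t ^ k := fun a k => by
            induction k with
            | zero => simpa using h0
            | succ k ih => rw [succ_nsmul, hadd, ih, pow_succ]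
          rw [Finsupp.weight_eq_sum]
          simp only [← hn]
          generalize (Finset.univ : Finset (Fin n)) = s
          induction s using Finset.induction_on with
          | empty => simpa using h0
          | insert j s hj ih => rw [Finset.sum_insert hj, Finset.prod_insert hj, hadd, ih]
        rw [h1, Finsupp.prod_fintype _ _ (by simp)]
        refine Finset.prod_congr rfl fun j _ => ?_
        by_cases hj : u j = 0
        · simp [hj]
        · simp [torusAct, hu j hj, hχ]
      · rw [degMap_monomial_of_neg A hu]
        push Not at hu
        obtain ⟨j, hj, hjτ⟩ := hu
        rw [Finsupp.prod, Finset.prod_eq_zero (Finsupp.mem_support_iff.2 hj), mul_zero]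
        · simp
        · simp [torusAct, hjτ, hj]
  ext f
  rw [hcl, mem_vanishingIdeal_iff, mem_toricIdeal_iff]
  constructor
  · intro h
    have h0 : E (degMap A (fun u => ∀ j, u j ≠ 0 → j ∈ τ) f) = 0 := by
      funext t
      rw [← hE]
      exact h _ ⟨t, rfl⟩
    exact (linearIndependent_iff.1 hli) _ h0
  · rintro h _ ⟨t, rfl⟩
    change aeval (torusAct A t fun j => if j ∈ τ then 1 else 0) f = 0
    rw [hE, h, map_zero, Pi.zero_apply]

/-! ### The initial ideal -/

/-- The exponent `u` has minimal `L`-degree among the exponents of the same `ℤ^d`-degree. -/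
def IsMinExp (A : Matrix (Fin d) (Fin n) ℤ) (L : Fin n → ℚ) (u : Fin n →₀ ℕ) : Prop :=
  ∀ v : Fin n →₀ ℕ, Finsupp.weight A.col v = Finsupp.weight A.col u →
    Finsupp.weight L u ≤ Finsupp.weight L v

theorem isStable_isMinExp (A : Matrix (Fin d) (Fin n) ℤ) (L : Fin n → ℚ) :
    IsStable A (IsMinExp A L) where
  of_add := fun {u v} h w hw => by
    have := h (w + v) (by rw [map_add, map_add, hw])
    rw [map_add, map_add] at this
    linarith
  add_congr := fun {u v w} huv hu hv h x hx => by
    have h1 := h x (by rw [hx, map_add, map_add, huv])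
    have h2 := hv u huv
    rw [map_add] at h1 ⊢
    linarith

theorem degMap_sum_monomial (A : Matrix (Fin d) (Fin n) ℤ) (P : (Fin n →₀ ℕ) → Prop)
    [DecidablePred P] (s : Finset (Fin n →₀ ℕ)) (c : (Fin n →₀ ℕ) → ℂ) (a : Fin d → ℤ) :
    degMap A P (∑ u ∈ s, monomial u (c u)) a =
      ∑ u ∈ s with P u ∧ Finsupp.weight A.col u = a, c u := by
  rw [map_sum, Finsupp.finsetSum_apply, Finset.sum_filter]
  refine Finset.sum_congr rfl fun u _ => ?_
  by_cases hu : P u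
  · simp [degMap_monomial_of_pos A hu, Finsupp.single_apply, hu]
  · simp [degMap_monomial_of_neg A hu, hu]

theorem symbol_sub_of_lt {L : Fin n → ℚ} {u v : Fin n →₀ ℕ}
    (h : Finsupp.weight L v < Finsupp.weight L u) :
    symbol L (monomial u 1 - monomial v 1) = monomial u 1 := by
  classical
  have hne : u ≠ v := by rintro rfl; exact h.false
  have hs : (monomial u 1 - monomial v 1 : MvPolynomial (Fin n) ℂ).support = {u, v} := by
    ext w
    simp only [mem_support_iff, coeff_sub, coeff_monomial, Finset.mem_insert,
      Finset.mem_singleton]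
    by_cases h1 : u = w <;> by_cases h2 : v = w <;> simp_all [eq_comm]
  rw [symbol, hs, Finset.sum_eq_single_of_mem u]
  · simp [coeff_monomial, hne.symm]
  · simp [h.le]
  · intro w hw hwu
    simp only [Finset.mem_filter, Finset.mem_insert, Finset.mem_singleton] at hw
    obtain rfl : w = v := hw.1.resolve_left hwu
    exact absurd (hw.2 u (Or.inl rfl)) (not_le.2 h)

theorem symbol_sub_of_eq {L : Fin n → ℚ} {u v : Fin n →₀ ℕ}
    (h : Finsupp.weight L u = Finsupp.weight L v) :
    symbol L (monomial u 1 - monomial v 1) = monomial u 1 - monomial v 1 := by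
  classical
  have hs : (monomial u 1 - monomial v 1 : MvPolynomial (Fin n) ℂ).support ⊆ {u, v} := by
    intro w
    simp only [mem_support_iff, coeff_sub, coeff_monomial, Finset.mem_insert,
      Finset.mem_singleton]
    by_cases h1 : u = w <;> by_cases h2 : v = w <;> simp_all [eq_comm]
  have hw : ∀ w ∈ (monomial u 1 - monomial v 1 : MvPolynomial (Fin n) ℂ).support,
      Finsupp.weight L w = Finsupp.weight L u := fun w hw => by
    rcases Finset.mem_insert.1 (hs hw) with rfl | hw
    · rfl
    · rw [Finset.mem_singleton.1 hw, h]
  rw [symbol, Finset.filter_true_of_mem fun u' hu' v' hv' => by rw [hw _ hu', hw _ hv']]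
  exact support_sum_monomial_coeff _

/-- The initial ideal is generated by the monomials of nonminimal exponents and the differences of
monomials of minimal exponents in the same fibre. In particular `S_A^L` has dimension at most one
in each `ℤ^d`-degree. -/
theorem gradedIdeal_eq_fiberIdeal (A : Matrix (Fin d) (Fin n) ℤ) (L : Fin n → ℚ) :
    gradedIdeal A L = fiberIdeal A (IsMinExp A L) := by
  classical
  have hbin : ∀ u v : Fin n →₀ ℕ, Finsupp.weight A.col u = Finsupp.weight A.col v →
      (monomial u 1 - monomial v 1 : MvPolynomial (Fin n) ℂ) ∈ toricIdeal A Finset.univ := by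
    intro u v huv
    rw [toricIdeal_eq_fiberIdeal]
    exact sub_mem_fiberIdeal (by simp) (by simp) huv
  apply le_antisymm
  · refine Ideal.span_le.2 ?_
    rintro _ ⟨f, hf, rfl⟩
    apply mem_fiberIdeal_of_degMap_eq_zero
    ext a
    rw [symbol, degMap_sum_monomial]
    by_cases hex : ∃ u₀ ∈ f.support, (∀ v ∈ f.support, Finsupp.weight L v ≤ Finsupp.weight L u₀) ∧
        IsMinExp A L u₀ ∧ Finsupp.weight A.col u₀ = a
    · obtain ⟨u₀, hu₀, hmax, hmin, hwt⟩ := hex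
      -- All terms of degree `a` of `f` have the same `L`-degree, both maximal and minimal.
      have h0 : degMap A (fun u => ∀ j, u j ≠ 0 → j ∈ Finset.univ) f a = 0 := by
        rw [mem_toricIdeal_iff.1 hf]; rfl
      rw [as_sum f, degMap_sum_monomial] at h0
      rw [Finsupp.zero_apply, ← h0]
      refine Finset.sum_congr ?_ fun _ _ => rfl
      ext u
      simp only [Finset.mem_filter]
      constructor
      · rintro ⟨⟨h1, -⟩, -, h3⟩
        exact ⟨h1, by simp, h3⟩
      · rintro ⟨h1, -, h3⟩
        have hL : Finsupp.weight L u = Finsupp.weight L u₀ :=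
          le_antisymm (hmax u h1) (hmin u (h3.trans hwt.symm))
        exact ⟨⟨h1, fun v hv => hL ▸ hmax v hv⟩, fun v hv =>
          hL ▸ hmin v (hv.trans (h3.trans hwt.symm)), h3⟩
    · rw [Finset.filter_false_of_mem]
      · simp
      · rintro u hu ⟨h1, h2⟩
        rw [Finset.mem_filter] at hu
        exact hex ⟨u, hu.1, hu.2, h1, h2⟩
  · refine fiberIdeal_le (fun u hu => ?_) fun u v hu hv huv => ?_
    · unfold IsMinExp at hu
      push Not at hu
      obtain ⟨v, hv, hlt⟩ := hu
      rw [← symbol_sub_of_lt hlt]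
      exact Ideal.subset_span ⟨_, hbin u v hv.symm, rfl⟩
    · rw [← symbol_sub_of_eq (le_antisymm (hu v huv.symm) (hv u huv))]
      exact Ideal.subset_span ⟨_, hbin u v huv, rfl⟩

/-- An exponent with support in a face is minimal, and every minimal exponent of its fibre has
support in the face. -/
theorem IsFace.gradedIdeal_le_toricIdeal {A : Matrix (Fin d) (Fin n) ℤ} {L : Fin n → ℚ}
    {τ : Finset (Fin n)} (hτ : IsFace A L τ) : gradedIdeal A L ≤ toricIdeal A τ := by
  obtain ⟨w, hw, hw'⟩ := hτ
  have hmin : ∀ u : Fin n →₀ ℕ, (∀ j, u j ≠ 0 → j ∈ τ) → IsMinExp A L u := fun u hu v hv => by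
    rw [← ((linearForm_weight_le hw hw' u).2).2 hu, ← hv]
    exact (linearForm_weight_le hw hw' v).1
  have hmem : ∀ u v : Fin n →₀ ℕ, (∀ j, u j ≠ 0 → j ∈ τ) → IsMinExp A L v →
      Finsupp.weight A.col u = Finsupp.weight A.col v → ∀ j, v j ≠ 0 → j ∈ τ :=
    fun u v hu hv huv => by
      refine (linearForm_weight_le hw hw' v).2.1
        (le_antisymm (linearForm_weight_le hw hw' v).1 ?_)
      rw [← huv, ((linearForm_weight_le hw hw' u).2).2 hu]
      exact hv u huv
  rw [gradedIdeal_eq_fiberIdeal, toricIdeal_eq_fiberIdeal]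
  refine fiberIdeal_le (fun u hu => monomial_mem_fiberIdeal (mt (hmin u) hu))
    fun u v hu hv huv => ?_
  by_cases h : ∀ j, u j ≠ 0 → j ∈ τ
  · exact sub_mem_fiberIdeal h (hmem u v h hv huv) huv
  · exact sub_mem (monomial_mem_fiberIdeal h)
      (monomial_mem_fiberIdeal fun h' => h (hmem v u h' hu huv.symm))

theorem monomial_notMem_of_isPrime {P : Ideal (MvPolynomial (Fin n) ℂ)} [P.IsPrime]
    {u : Fin n →₀ ℕ} : monomial u 1 ∉ P ↔ ∀ j, u j ≠ 0 → X j ∉ P := by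
  rw [monomial_eq, C_1, one_mul, Finsupp.prod, Ideal.IsPrime.prod_mem_iff]
  push Not
  simp only [Finsupp.mem_support_iff]
  refine forall₂_congr fun j hj => not_congr ?_
  exact ⟨Ideal.IsPrime.mem_of_pow_mem inferInstance _, fun h => Ideal.pow_mem_of_mem _ h _
    (Nat.pos_of_ne_zero hj)⟩

/-- The variables outside a prime ideal containing the initial ideal form a face. -/
theorem isFace_of_isPrime {A : Matrix (Fin d) (Fin n) ℤ} {L : Fin n → ℚ}
    {P : Ideal (MvPolynomial (Fin n) ℂ)} [P.IsPrime] (hP : gradedIdeal A L ≤ P)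
    {τ : Finset (Fin n)} (hτ : ∀ j, j ∈ τ ↔ X j ∉ P) :
    IsFace A L τ ∧ toricIdeal A τ ≤ P := by
  have hmon : ∀ u : Fin n →₀ ℕ, monomial u 1 ∉ P ↔ ∀ j, u j ≠ 0 → j ∈ τ := fun u => by
    rw [monomial_notMem_of_isPrime]; simp only [hτ]
  have hmin : ∀ u : Fin n →₀ ℕ, (∀ j, u j ≠ 0 → j ∈ τ) → IsMinExp A L u := fun u hu => by
    by_contra h
    refine (hmon u).2 hu (hP ?_)
    rw [gradedIdeal_eq_fiberIdeal]
    exact monomial_mem_fiberIdeal h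
  have hsub : ∀ u v : Fin n →₀ ℕ, IsMinExp A L u → IsMinExp A L v →
      Finsupp.weight A.col u = Finsupp.weight A.col v → monomial u 1 - monomial v 1 ∈ P :=
    fun u v hu hv huv => hP (by
      rw [gradedIdeal_eq_fiberIdeal]; exact sub_mem_fiberIdeal hu hv huv)
  constructor
  · refine isFace_of_forall_exponent fun u v hv huv hle => ?_
    have hvm := hmin v hv
    have heq := le_antisymm hle (hvm u huv)
    have hum : IsMinExp A L u := fun x hx => heq ▸ hvm x (hx.trans huv)
    refine ⟨heq, (hmon u).1 fun hu => (hmon v).2 hv ?_⟩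
    simpa using sub_mem hu (hsub u v hum hvm huv)
  · rw [toricIdeal_eq_fiberIdeal]
    exact fiberIdeal_le (fun u hu => by_contra fun h => hu ((hmon u).1 h))
      fun u v hu hv huv => hsub u v (hmin u hu) (hmin v hv) huv

/-- Fibres of the degree map are finite, so each nonempty fibre contains a minimal exponent. -/
theorem exists_isMinExp {A : Matrix (Fin d) (Fin n) ℤ} (hA : IsAdmissible A) (L : Fin n → ℚ)
    (u : Fin n →₀ ℕ) : ∃ v, IsMinExp A L v ∧ Finsupp.weight A.col v = Finsupp.weight A.col u := by
  obtain ⟨h, hh⟩ := exists_pos_linearForm hA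
  have hfin : {v : Fin n →₀ ℕ | Finsupp.weight A.col v = Finsupp.weight A.col u}.Finite := by
    refine (Set.finite_Iic (Finsupp.equivFunOnFinite.symm fun j =>
      ⌈h (castVec d (Finsupp.weight A.col u)) / h (ratCol A j)⌉₊)).subset fun v hv j => ?_
    rw [Set.mem_ofPred_eq] at hv
    rw [← hv, castVec_weight]
    simp only [map_sum, map_smul, smul_eq_mul, Finsupp.equivFunOnFinite_symm_apply_apply]
    have : (v j : ℚ) ≤ (∑ i, (v i : ℚ) * h (ratCol A i)) / h (ratCol A j) := by
      rw [le_div_iff₀ (hh j)]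
      exact Finset.single_le_sum (f := fun i => (v i : ℚ) * h (ratCol A i))
        (fun i _ => mul_nonneg (by positivity) (hh i).le) (Finset.mem_univ j)
    exact_mod_cast this.trans (Nat.le_ceil _)
  obtain ⟨v, hv, hmin⟩ := Set.exists_min_image _ (Finsupp.weight L) hfin ⟨u, rfl⟩
  exact ⟨v, fun x hx => hmin x (hx.trans hv), hv⟩

/-! ### A filtration with toric quotients -/

/-- The exponents remaining after the degrees of the nonzero multiples of `∂^s` are removed. -/
def removeMultiples (A : Matrix (Fin d) (Fin n) ℤ) (P : (Fin n →₀ ℕ) → Prop) (s : Fin n →₀ ℕ)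
    (u : Fin n →₀ ℕ) : Prop :=
  P u ∧ ¬ ∃ w, P (s + w) ∧ Finsupp.weight A.col (s + w) = Finsupp.weight A.col u

theorem IsStable.shift {A : Matrix (Fin d) (Fin n) ℤ} {P : (Fin n →₀ ℕ) → Prop}
    (hP : IsStable A P) (s : Fin n →₀ ℕ) : IsStable A fun u => P (s + u) where
  of_add := fun {u v} h => hP.of_add (v := v) (by rwa [add_assoc])
  add_congr := fun {u v w} huv hu hv h => by
    rw [← add_assoc] at h ⊢
    exact hP.add_congr (by rw [map_add, map_add, huv]) hu hv h

theorem IsStable.isStable_removeMultiples {A : Matrix (Fin d) (Fin n) ℤ} {P : (Fin n →₀ ℕ) → Prop}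
    (hP : IsStable A P) (s : Fin n →₀ ℕ) : IsStable A (removeMultiples A P s) where
  of_add := fun {u v} h => by
    refine ⟨hP.of_add h.1, ?_⟩
    rintro ⟨w, hw, hwu⟩
    refine h.2 ⟨w + v, ?_, ?_⟩
    · rw [← add_assoc]
      exact hP.add_congr hwu.symm (hP.of_add h.1) hw h.1
    · rw [← add_assoc, map_add, hwu, map_add]
  add_congr := fun {u v w} huv hu hv h => by
    refine ⟨hP.add_congr huv hu.1 hv.1 h.1, ?_⟩
    rw [map_add, ← huv, ← map_add]
    exact h.2

theorem fiberIdeal_removeMultiples {A : Matrix (Fin d) (Fin n) ℤ}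
    {P : (Fin n →₀ ℕ) → Prop} {s : Fin n →₀ ℕ} (hs : P s) :
    fiberIdeal A (removeMultiples A P s) = fiberIdeal A P ⊔ Ideal.span {monomial s 1} := by
  apply le_antisymm
  · refine fiberIdeal_le (fun u hu => ?_) fun u v hu hv huv =>
      Ideal.mem_sup_left (sub_mem_fiberIdeal hu.1 hv.1 huv)
    by_cases hPu : P u
    · obtain ⟨w, hw, hwu⟩ : ∃ w, P (s + w) ∧
          Finsupp.weight A.col (s + w) = Finsupp.weight A.col u := by
        by_contra h; exact hu ⟨hPu, h⟩
      have : (monomial u 1 : MvPolynomial (Fin n) ℂ) =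
          (monomial u 1 - monomial (s + w) 1) + monomial w 1 * monomial s 1 := by
        rw [monomial_mul, one_mul, add_comm w s, sub_add_cancel]
      rw [this]
      exact add_mem (Ideal.mem_sup_left (sub_mem_fiberIdeal hPu hw hwu.symm))
        (Ideal.mul_mem_left _ _ (Ideal.mem_sup_right (Ideal.mem_span_singleton_self _)))
    · exact Ideal.mem_sup_left (monomial_mem_fiberIdeal hPu)
  · refine sup_le (fiberIdeal_le (fun u hu => monomial_mem_fiberIdeal fun h => hu h.1)
      fun u v hu hv huv => ?_) ?_
    · by_cases h : removeMultiples A P s u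
      · exact sub_mem_fiberIdeal h ⟨hv, by rw [← huv]; exact h.2⟩ huv
      · exact sub_mem (monomial_mem_fiberIdeal h)
          (monomial_mem_fiberIdeal fun h' => h ⟨hu, by rw [huv]; exact h'.2⟩)
    · rw [Ideal.span_singleton_le_iff_mem]
      exact monomial_mem_fiberIdeal fun h => h.2 ⟨0, by simpa using hs, by simp⟩

/-- The annihilator of the class of `∂^s`. -/
theorem IsStable.mul_monomial_mem_iff {A : Matrix (Fin d) (Fin n) ℤ}
    {P : (Fin n →₀ ℕ) → Prop} (hP : IsStable A P) (s : Fin n →₀ ℕ)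
    {f : MvPolynomial (Fin n) ℂ} :
    f * monomial s 1 ∈ fiberIdeal A P ↔ f ∈ fiberIdeal A fun u => P (s + u) := by
  rw [hP.mem_fiberIdeal_iff, (hP.shift s).mem_fiberIdeal_iff]
  have key : degMap A P ∘ₗ LinearMap.mulRight ℂ (monomial s 1) =
      Finsupp.lmapDomain ℂ ℂ (fun a => Finsupp.weight A.col s + a) ∘ₗ
        degMap A fun u => P (s + u) := by
    refine MvPolynomial.linearMap_ext fun u => LinearMap.ext fun b => ?_
    simp only [LinearMap.comp_apply, LinearMap.mulRight_apply, monomial_mul, mul_one]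
    rw [add_comm u s]
    by_cases hu : P (s + u)
    · rw [degMap_monomial_of_pos A hu,
        degMap_monomial_of_pos (P := fun u => P (s + u)) A hu, Finsupp.lmapDomain_apply,
        Finsupp.mapDomain_single, map_add]
    · rw [degMap_monomial_of_neg A hu,
        degMap_monomial_of_neg (P := fun u => P (s + u)) A hu, map_zero]
  have h := LinearMap.congr_fun key f
  simp only [LinearMap.comp_apply, LinearMap.mulRight_apply, Finsupp.lmapDomain_apply] at h
  rw [h]
  refine ⟨fun h0 => ?_, fun h0 => by rw [h0, Finsupp.mapDomain_zero]⟩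
  exact Finsupp.mapDomain_injective (add_right_injective (Finsupp.weight A.col s))
    (h0.trans Finsupp.mapDomain_zero.symm)

/-- Among the nonzero monomials of the quotient by `fiberIdeal A P`, one with maximal annihilator
has a toric ideal as its annihilator. -/
theorem IsStable.exists_toric_shift {A : Matrix (Fin d) (Fin n) ℤ}
    {P : (Fin n →₀ ℕ) → Prop} (hP : IsStable A P) (hne : ∃ u, P u) :
    ∃ (s : Fin n →₀ ℕ) (τ : Finset (Fin n)), P s ∧ ∀ w, P (s + w) ↔ ∀ j, w j ≠ 0 → j ∈ τ := by
  classical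
  let I : (Fin n →₀ ℕ) → Ideal (MvPolynomial (Fin n) ℂ) := fun s => fiberIdeal A fun u => P (s + u)
  obtain ⟨_, ⟨s, hs, rfl⟩, hmax⟩ := set_has_maximal_iff_noetherian.2
    (inferInstance : IsNoetherian (MvPolynomial (Fin n) ℂ) (MvPolynomial (Fin n) ℂ))
    (I '' {s | P s}) (Set.Nonempty.image I hne)
  have hle : ∀ u, I s ≤ I (s + u) := fun u => by
    refine fiberIdeal_le (fun v hv => monomial_mem_fiberIdeal fun h => hv ?_)
      fun v v' hv hv' hvv => ?_
    · rw [add_right_comm] at h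
      exact hP.of_add h
    · have aux : ∀ {v v'}, P (s + v) → P (s + v') → Finsupp.weight A.col v =
          Finsupp.weight A.col v' → P (s + u + v) → P (s + u + v') := by
        intro v v' hv hv' hvv h
        rw [add_right_comm] at h ⊢
        exact hP.add_congr (by rw [map_add, map_add, hvv]) hv hv' h
      by_cases h : P (s + u + v)
      · exact sub_mem_fiberIdeal h (aux hv hv' hvv h) hvv
      · exact sub_mem (monomial_mem_fiberIdeal h)
          (monomial_mem_fiberIdeal fun h' => h (aux hv' hv hvv.symm h'))
  -- By maximality, multiplying by a further nonzero monomial does not change the annihilator.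
  have hadd : ∀ u v, P (s + u) → P (s + v) → P (s + (u + v)) := fun u v hu hv => by
    have heq : I s = I (s + u) := by
      by_contra h
      exact hmax _ ⟨s + u, hu, rfl⟩ (lt_of_le_of_ne (hle u) h)
    by_contra h
    rw [← add_assoc] at h
    have h1 : monomial v 1 ∈ I (s + u) := monomial_mem_fiberIdeal h
    rw [← heq] at h1
    exact ((hP.shift s).monomial_mem_iff.1 h1) hv
  refine ⟨s, Finset.univ.filter fun j => P (s + Finsupp.single j 1), hs, fun w => ?_⟩
  simp only [Finset.mem_filter, Finset.mem_univ, true_and]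
  constructor
  · intro hw j hj
    refine (hP.shift s).of_add (v := w - Finsupp.single j 1) ?_
    rwa [add_tsub_cancel_of_le (Finsupp.single_le_iff.2 (Nat.one_le_iff_ne_zero.2 hj))]
  · intro hw
    have hk : ∀ j (k : ℕ), P (s + Finsupp.single j 1) → P (s + Finsupp.single j k) := by
      intro j k hj
      induction k with
      | zero => simpa using hs
      | succ k ih => rw [Finsupp.single_add]; exact hadd _ _ ih hj
    induction w using Finsupp.induction with
    | zero => simpa using hs
    | single_add j k f hj hk0 ih =>
      refine hadd _ _ (hk j k (hw j ?_)) (ih fun i hi => hw i ?_)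
      · simp [Finsupp.notMem_support_iff.1 hj, hk0]
      · simp [hi]

/-- The data of a filtration by ideals `fiberIdeal A (P k)`, `k ≤ l`, from `fiberIdeal A P₀` to the
unit ideal, in which the class of `∂^(s k)` generates the `k`-th quotient and has the toric ideal of
`τ k` as its annihilator. -/
structure IsToricFiltration (A : Matrix (Fin d) (Fin n) ℤ) (P₀ : (Fin n →₀ ℕ) → Prop) (l : ℕ)
    (P : ℕ → (Fin n →₀ ℕ) → Prop) (s : ℕ → Fin n →₀ ℕ) (τ : ℕ → Finset (Fin n)) : Prop where
  zero : P 0 = P₀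
  last : ∀ u, ¬ P l u
  stable : ∀ k, IsStable A (P k)
  mem : ∀ k < l, P k (s k)
  toric : ∀ k < l, ∀ w, P k (s k + w) ↔ ∀ j, w j ≠ 0 → j ∈ τ k
  succ : ∀ k < l, P (k + 1) = removeMultiples A (P k) (s k)

theorem IsStable.exists_isToricFiltration {A : Matrix (Fin d) (Fin n) ℤ}
    {P₀ : (Fin n →₀ ℕ) → Prop} (hP₀ : IsStable A P₀) :
    ∃ l P s τ, IsToricFiltration A P₀ l P s τ := by
  classical
  have hex : ∀ P : {P : (Fin n →₀ ℕ) → Prop // IsStable A P}, ∃ s : Fin n →₀ ℕ,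
      ∃ τ : Finset (Fin n), (∃ u, P.1 u) →
        P.1 s ∧ ∀ w, P.1 (s + w) ↔ ∀ j, w j ≠ 0 → j ∈ τ := fun P => by
    by_cases h : ∃ u, P.1 u
    · obtain ⟨s, τ, hs⟩ := P.2.exists_toric_shift h
      exact ⟨s, τ, fun _ => hs⟩
    · exact ⟨0, ∅, fun h' => absurd h' h⟩
  choose s τ hsτ using hex
  let F : ℕ → {P : (Fin n →₀ ℕ) → Prop // IsStable A P} := fun k =>
    Nat.rec ⟨P₀, hP₀⟩ (fun _ P => ⟨removeMultiples A P.1 (s P), P.2.isStable_removeMultiples _⟩) k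
  have hF : ∀ k, (F (k + 1)).1 = removeMultiples A (F k).1 (s (F k)) := fun k => rfl
  have hlt : ∀ k, (∃ u, (F k).1 u) → fiberIdeal A (F k).1 < fiberIdeal A (F (k + 1)).1 := by
    intro k hk
    rw [hF, fiberIdeal_removeMultiples (hsτ _ hk).1]
    refine lt_of_le_of_ne le_sup_left fun h => ?_
    have : monomial (s (F k)) 1 ∈ fiberIdeal A (F k).1 := by
      rw [h]; exact Ideal.mem_sup_right (Ideal.mem_span_singleton_self _)
    exact (F k).2.monomial_mem_iff.1 this (hsτ _ hk).1
  have hend : ∃ l, ∀ u, ¬ (F l).1 u := by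
    by_contra hcon
    push Not at hcon
    have hmono : StrictMono fun k => fiberIdeal A (F k).1 :=
      strictMono_nat_of_lt_succ fun k => hlt k (hcon k)
    obtain ⟨N, hN⟩ := monotone_stabilizes_iff_noetherian.2
      (inferInstance : IsNoetherian (MvPolynomial (Fin n) ℂ) (MvPolynomial (Fin n) ℂ))
      ⟨_, hmono.monotone⟩
    exact (hmono (Nat.lt_succ_self N)).ne (hN (N + 1) (Nat.le_succ N))
  have hne : ∀ k < Nat.find hend, ∃ u, (F k).1 u := fun k hk => by
    have := Nat.find_min hend hk
    push Not at this
    exact this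
  exact ⟨Nat.find hend, fun k => (F k).1, fun k => s (F k), fun k => τ (F k), rfl,
    Nat.find_spec hend, fun k => (F k).2, fun k hk => (hsτ _ (hne k hk)).1,
    fun k hk => (hsτ _ (hne k hk)).2, fun k _ => hF k⟩

namespace IsToricFiltration

variable {A : Matrix (Fin d) (Fin n) ℤ} {P₀ : (Fin n →₀ ℕ) → Prop} {l : ℕ}
  {P : ℕ → (Fin n →₀ ℕ) → Prop} {s : ℕ → Fin n →₀ ℕ} {τ : ℕ → Finset (Fin n)}

theorem fiberIdeal_zero (H : IsToricFiltration A P₀ l P s τ) :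
    fiberIdeal A (P 0) = fiberIdeal A P₀ := by rw [H.zero]

theorem fiberIdeal_last (H : IsToricFiltration A P₀ l P s τ) : fiberIdeal A (P l) = ⊤ :=
  (Ideal.eq_top_iff_one _).2 (monomial_mem_fiberIdeal (H.last 0))

theorem fiberIdeal_succ (H : IsToricFiltration A P₀ l P s τ) {k : ℕ} (hk : k < l) :
    fiberIdeal A (P (k + 1)) = fiberIdeal A (P k) ⊔ Ideal.span {monomial (s k) 1} := by
  rw [H.succ k hk, fiberIdeal_removeMultiples (H.mem k hk)]

theorem mul_mem_iff (H : IsToricFiltration A P₀ l P s τ) {k : ℕ} (hk : k < l)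
    {f : MvPolynomial (Fin n) ℂ} :
    f * monomial (s k) 1 ∈ fiberIdeal A (P k) ↔ f ∈ toricIdeal A (τ k) := by
  rw [(H.stable k).mul_monomial_mem_iff, toricIdeal_eq_fiberIdeal]
  have : (fun u => P k (s k + u)) = fun u => ∀ j, u j ≠ 0 → j ∈ τ k :=
    funext fun w => propext (H.toric k hk w)
  rw [this]

theorem le_toricIdeal (H : IsToricFiltration A P₀ l P s τ) {k : ℕ} (hk : k < l) :
    fiberIdeal A P₀ ≤ toricIdeal A (τ k) := by
  have h : ∀ m ≤ l, fiberIdeal A P₀ ≤ fiberIdeal A (P m) := fun m hm => by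
    induction m with
    | zero => rw [H.fiberIdeal_zero]
    | succ m ih => rw [H.fiberIdeal_succ hm]; exact (ih (by omega)).trans le_sup_left
  exact fun f hf => (H.mul_mem_iff hk).1 (Ideal.mul_mem_right _ _ (h k hk.le hf))

/-- The degrees of the quotients cover all degrees of the filtered ring. -/
theorem exists_weight_eq (H : IsToricFiltration A P₀ l P s τ) {u : Fin n →₀ ℕ} (hu : P₀ u) :
    ∃ k < l, ∃ w : Fin n →₀ ℕ, (∀ j, w j ≠ 0 → j ∈ τ k) ∧
      Finsupp.weight A.col u = Finsupp.weight A.col (s k) + Finsupp.weight A.col w := by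
  by_contra hcon
  have h : ∀ m ≤ l, P m u := fun m hm => by
    induction m with
    | zero => rwa [H.zero]
    | succ m ih =>
      rw [H.succ m hm]
      refine ⟨ih (by omega), ?_⟩
      rintro ⟨w, hw, hwu⟩
      exact hcon ⟨m, hm, w, (H.toric m hm w).1 hw, by rw [← hwu, map_add]⟩
  exact H.last u (h l le_rfl)

theorem eq_of_weight_eq (H : IsToricFiltration A P₀ l P s τ) {k k' : ℕ} (hk : k < l)
    (hk' : k' < l) {w w' : Fin n →₀ ℕ} (hw : ∀ j, w j ≠ 0 → j ∈ τ k)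
    (hw' : ∀ j, w' j ≠ 0 → j ∈ τ k')
    (h : Finsupp.weight A.col (s k) + Finsupp.weight A.col w =
      Finsupp.weight A.col (s k') + Finsupp.weight A.col w') : k = k' := by
  by_contra hne
  wlog hlt : k < k' generalizing k k' w w'
  · exact this hk' hk hw' hw h.symm (Ne.symm hne) (lt_of_le_of_ne (not_lt.1 hlt) (Ne.symm hne))
  have hanti : ∀ m, k + 1 + m ≤ l → ∀ u, P (k + 1 + m) u → P (k + 1) u := fun m => by
    induction m with
    | zero => exact fun _ _ h => h
    | succ m ih =>
      intro hm u hu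
      rw [← add_assoc, H.succ _ (by omega)] at hu
      exact ih (by omega) u hu.1
  have h1 : P k' (s k' + w') := (H.toric k' hk' w').2 hw'
  obtain ⟨m, rfl⟩ := Nat.exists_eq_add_of_le (Nat.succ_le_of_lt hlt)
  have h2 := hanti m hk'.le _ h1
  rw [H.succ k hk] at h2
  exact h2.2 ⟨w, (H.toric k hk w).2 hw, by rw [map_add, map_add, h]⟩

end IsToricFiltration

theorem IsGraded.sup_span {A : Matrix (Fin d) (Fin n) ℤ} {I : Ideal (MvPolynomial (Fin n) ℂ)}
    {N : Submodule (MvPolynomial (Fin n) ℂ) (MvPolynomial (Fin n) ℂ ⧸ I)} (hN : IsGraded A I N)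
    {x : MvPolynomial (Fin n) ℂ ⧸ I} {a : Fin d → ℤ} (hx : x ∈ gradedPart A I a) :
    IsGraded A I (N ⊔ Submodule.span _ {x}) := by
  refine le_antisymm (Submodule.span_le.2 fun y hy => hy.1) (sup_le ?_ ?_)
  · conv_lhs => rw [← hN]
    exact Submodule.span_mono fun y hy => ⟨Submodule.mem_sup_left hy.1, hy.2⟩
  · rw [Submodule.span_singleton_le_iff_mem]
    exact Submodule.subset_span
      ⟨Submodule.mem_sup_right (Submodule.mem_span_singleton_self x), a, hx⟩

/-- A filtration with toric quotients, viewed in `S_A^L`, is a composition chain. -/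
theorem IsToricFiltration.isCompositionChain {A : Matrix (Fin d) (Fin n) ℤ}
    (hA : IsAdmissible A) {L : Fin n → ℚ} {l : ℕ}
    {P : ℕ → (Fin n →₀ ℕ) → Prop} {s : ℕ → Fin n →₀ ℕ} {τ : ℕ → Finset (Fin n)}
    (H : IsToricFiltration A (IsMinExp A L) l P s τ) :
    IsCompositionChain A L l
      (fun k => Submodule.map (gradedIdeal A L).mkQ (fiberIdeal A (P k)))
      (fun k => τ k) fun k => Finsupp.weight A.col (s k) := by
  have hI := gradedIdeal_eq_fiberIdeal A L
  have hsucc : ∀ k < l, Submodule.map (gradedIdeal A L).mkQ (fiberIdeal A (P (k + 1))) =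
      Submodule.map (gradedIdeal A L).mkQ (fiberIdeal A (P k)) ⊔
        Submodule.span _ {(gradedIdeal A L).mkQ (monomial (s k) 1)} := fun k hk => by
    rw [H.fiberIdeal_succ hk, Submodule.map_sup, Ideal.span, Submodule.map_span,
      Set.image_singleton]
  have hbot : Submodule.map (gradedIdeal A L).mkQ (fiberIdeal A (P 0)) = ⊥ := by
    rw [H.zero, ← hI, Submodule.mkQ_map_self]
  have hle : ∀ k ≤ l, gradedIdeal A L ≤ fiberIdeal A (P k) := fun k hk => by
    induction k with
    | zero => rw [H.zero, hI]
    | succ k ih => rw [H.fiberIdeal_succ hk]; exact (ih (by omega)).trans le_sup_left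
  refine ⟨hbot, ?_, ?_, ?_, ?_, ?_⟩
  · rw [Fin.val_last, H.fiberIdeal_last, Submodule.map_top, Submodule.range_mkQ]
  · rintro ⟨k, hk⟩
    change IsGraded A _ (Submodule.map (gradedIdeal A L).mkQ (fiberIdeal A (P k)))
    induction k with
    | zero =>
      rw [hbot]
      exact le_antisymm (Submodule.span_le.2 fun y hy => hy.1) bot_le
    | succ k ih =>
      rw [hsucc k (by omega)]
      exact (ih (by omega)).sup_span
        ⟨monomial (s k) 1, isWeightedHomogeneous_monomial _ _ _ rfl, rfl⟩
  · rintro ⟨k, hk⟩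
    change Submodule.map (gradedIdeal A L).mkQ (fiberIdeal A (P k)) ≤
      Submodule.map (gradedIdeal A L).mkQ (fiberIdeal A (P (k + 1)))
    rw [hsucc k hk]
    exact le_sup_left
  · rintro ⟨k, hk⟩
    have := toricIdeal_isPrime A (τ k)
    exact (mem_umbrella_iff hA).2 (isFace_of_isPrime (hI ▸ H.le_toricIdeal hk)
      fun j => by rw [X_mem_toricIdeal_iff, not_not]).1
  · rintro ⟨k, hk⟩
    let N := Submodule.map (gradedIdeal A L).mkQ (fiberIdeal A (P k))
    let N' := Submodule.map (gradedIdeal A L).mkQ (fiberIdeal A (P (k + 1)))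
    have hmem : (gradedIdeal A L).mkQ (monomial (s k) 1) ∈ N' := by
      simp only [N']
      rw [hsucc k hk]
      exact Submodule.mem_sup_right (Submodule.mem_span_singleton_self _)
    -- Multiplication by `∂^(s k)` induces the isomorphism from the toric ring, shifting degrees.
    let g : MvPolynomial (Fin n) ℂ →ₗ[MvPolynomial (Fin n) ℂ] N' ⧸ N.submoduleOf N' :=
      LinearMap.toSpanSingleton _ _ (Submodule.Quotient.mk ⟨_, hmem⟩)
    have hg : ∀ f, g f = Submodule.Quotient.mk
        ⟨(gradedIdeal A L).mkQ (f * monomial (s k) 1), by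
          rw [← smul_eq_mul, map_smul]; exact N'.smul_mem f hmem⟩ := fun f => by
      simp only [g, LinearMap.toSpanSingleton_apply]
      rw [← Submodule.Quotient.mk_smul]
      congr 1
    have hker : toricIdeal A (τ k) = LinearMap.ker g := by
      ext f
      rw [LinearMap.mem_ker, hg, Submodule.Quotient.mk_eq_zero, Submodule.submoduleOf,
        Submodule.mem_comap]
      change _ ↔ (gradedIdeal A L).mkQ (f * monomial (s k) 1) ∈ N
      simp only [N, Submodule.mem_map]
      rw [← H.mul_mem_iff hk]
      constructor
      · exact fun h => ⟨_, h, rfl⟩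
      · rintro ⟨y, hy, hyf⟩
        have h1 : f * monomial (s k) 1 - y ∈ gradedIdeal A L := by
          rw [← Submodule.ker_mkQ (gradedIdeal A L), LinearMap.mem_ker, map_sub, hyf, sub_self]
        simpa using add_mem (hle k hk.le h1) hy
    have hsurj : Function.Surjective g := by
      intro y
      obtain ⟨⟨y, hy⟩, rfl⟩ := Submodule.Quotient.mk_surjective _ y
      have hy' : y ∈ N ⊔ Submodule.span _ {(gradedIdeal A L).mkQ (monomial (s k) 1)} := by
        rw [← hsucc k hk]; exact hy
      obtain ⟨z, hz, w, hw, hzw⟩ := Submodule.mem_sup.1 hy'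
      obtain ⟨f, rfl⟩ := Submodule.mem_span_singleton.1 hw
      refine ⟨f, ?_⟩
      rw [hg, Submodule.Quotient.eq, Submodule.submoduleOf, Submodule.mem_comap]
      change (gradedIdeal A L).mkQ (f * monomial (s k) 1) - y ∈ N
      rw [← hzw, ← smul_eq_mul, map_smul, sub_add_cancel_right]
      exact neg_mem hz
    refine ⟨(Submodule.quotEquivOfEq _ _ hker).trans (g.quotKerEquivOfSurjective hsurj), ?_⟩
    rintro a _ ⟨f, hf, rfl⟩
    refine ⟨⟨(gradedIdeal A L).mkQ (f * monomial (s k) 1), by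
      rw [← smul_eq_mul, map_smul]; exact N'.smul_mem f hmem⟩, ⟨f * monomial (s k) 1, ?_, rfl⟩, ?_⟩
    · exact IsWeightedHomogeneous.mul hf (isWeightedHomogeneous_monomial _ _ _ rfl)
    · exact hg f

/-! ### Counting translates of a full-dimensional face -/

open scoped Classical in
/-- The exponent vector of `∏_{j ∈ σ} ∂_j`. -/
noncomputable def faceExp (σ : Finset (Fin n)) : Fin n →₀ ℕ :=
  Finsupp.equivFunOnFinite.symm fun j => if j ∈ σ then 1 else 0

theorem faceExp_ne_zero_iff {σ : Finset (Fin n)} {j : Fin n} : faceExp σ j ≠ 0 ↔ j ∈ σ := by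
  simp [faceExp]

/-- A sufficiently deep translate of any lattice point into the cone of a full-dimensional face
lies in the semigroup. -/
theorem IsFull.exists_weight_eq_add {A : Matrix (Fin d) (Fin n) ℤ} (hA : IsAdmissible A)
    {σ : Finset (Fin n)} (hfull : IsFull A σ) (c : Fin d → ℤ) :
    ∃ K : ℕ, ∀ k ≥ K, ∃ v : Fin n →₀ ℕ,
      Finsupp.weight A.col v = c + k • Finsupp.weight A.col (faceExp σ) := by
  set b := Finsupp.weight A.col (faceExp σ) with hb
  let G : (Fin d → ℤ) → Prop := fun c =>
    ∃ K : ℕ, ∀ k ≥ K, ∃ v : Fin n →₀ ℕ, Finsupp.weight A.col v = c + k • b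
  have hadd : ∀ c c', G c → G c' → G (c + c') := by
    rintro c c' ⟨K, hK⟩ ⟨K', hK'⟩
    refine ⟨K + K', fun k hk => ?_⟩
    obtain ⟨v, hv⟩ := hK K le_rfl
    obtain ⟨v', hv'⟩ := hK' (k - K) (by omega)
    refine ⟨v + v', ?_⟩
    rw [map_add, hv, hv', add_add_add_comm, ← add_nsmul, Nat.add_sub_cancel' (by omega)]
  have hcol : ∀ u : Fin n →₀ ℕ, G (Finsupp.weight A.col u) := fun u =>
    ⟨0, fun k _ => ⟨u + k • faceExp σ, by rw [map_add, map_nsmul]⟩⟩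
  have hcolj : ∀ j, Finsupp.weight A.col (Finsupp.single j 1) = A.col j := fun j => by
    rw [Finsupp.weight_single, one_smul]
  have hzero : G 0 := by simpa using hcol 0
  have hσ : ∀ z ∈ AddSubgroup.closure (A.col '' (σ : Set (Fin n))), G z ∧ G (-z) := by
    intro z hz
    induction hz using AddSubgroup.closure_induction with
    | mem z hz =>
      obtain ⟨j, hj, rfl⟩ := hz
      refine ⟨hcolj j ▸ hcol _, 1, fun k hk => ?_⟩
      have hle : Finsupp.single j 1 ≤ faceExp σ :=
        Finsupp.single_le_iff.2 (Nat.one_le_iff_ne_zero.2 (faceExp_ne_zero_iff.2 hj))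
      refine ⟨faceExp σ - Finsupp.single j 1 + (k - 1) • faceExp σ, ?_⟩
      have h1 : Finsupp.weight A.col (faceExp σ - Finsupp.single j 1) = -A.col j + b := by
        rw [hb, ← hcolj j]
        conv_rhs => rw [← tsub_add_cancel_of_le hle]
        rw [map_add]; simp
      rw [map_add, map_nsmul, h1, ← hb, add_assoc]
      congr 1
      rw [← succ_nsmul', Nat.sub_add_cancel hk]
    | zero => simpa using hzero
    | add x y _ _ hx hy =>
      refine ⟨hadd _ _ hx.1 hy.1, ?_⟩
      rw [neg_add]; exact hadd _ _ hx.2 hy.2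
    | neg x _ hx => exact ⟨hx.2, by simpa using hx.1⟩
  have hneg : ∀ j, G (-A.col j) := fun j => by
    -- `-a_j = (m - 1) a_j - m a_j`, where `m a_j` lies in the lattice of `σ`.
    obtain ⟨m, hm, hmem⟩ := hfull.exists_nsmul_mem (A.col j)
    have h1 : -A.col j = Finsupp.weight A.col (Finsupp.single j (m - 1)) + -(m • A.col j) := by
      obtain ⟨m, rfl⟩ := Nat.exists_eq_add_of_lt hm
      rw [Finsupp.weight_single]
      simp only [zero_add, Nat.add_sub_cancel, add_nsmul, one_nsmul]
      abel
    rw [h1]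
    exact hadd _ _ (hcol _) (hσ _ hmem).2
  have hall : ∀ c ∈ AddSubgroup.closure (Set.range A.col), G c ∧ G (-c) := by
    intro c hc
    induction hc using AddSubgroup.closure_induction with
    | mem z hz =>
      obtain ⟨j, rfl⟩ := hz
      exact ⟨hcolj j ▸ hcol _, hneg j⟩
    | zero => simpa using hzero
    | add x y _ _ hx hy =>
      refine ⟨hadd _ _ hx.1 hy.1, ?_⟩
      rw [neg_add]; exact hadd _ _ hx.2 hy.2
    | neg x _ hx => exact ⟨hx.2, by simpa using hx.1⟩
  exact (hall c (by rw [hA.span_eq_top]; trivial)).1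

/-- A translate of the semigroup of another face does not reach deep into the cone of a
full-dimensional face: the difference of the two linear forms bounds the depth. -/
theorem IsFull.exists_forall_ne {A : Matrix (Fin d) (Fin n) ℤ} {L : Fin n → ℚ}
    {σ τ : Finset (Fin n)} (hfull : IsFull A σ) (hσ : IsFace A L σ) (hτ : IsFace A L τ)
    (hne : τ ≠ σ) (c u : Fin d → ℤ) :
    ∃ K : ℕ, ∀ k ≥ K, ∀ w : Fin n →₀ ℕ, (∀ j, w j ≠ 0 → j ∈ τ) →
      c + k • Finsupp.weight A.col (faceExp σ) ≠ u + Finsupp.weight A.col w := by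
  have hsub : ¬ σ ⊆ τ := fun h => hne (hfull.eq_of_subset hσ hτ h).symm
  obtain ⟨f, hf, hf'⟩ := hσ
  obtain ⟨g, hg, hg'⟩ := hτ
  set b := Finsupp.weight A.col (faceExp σ) with hb
  let φ : (Fin d → ℤ) →+ ℚ := (g - f).toAddMonoidHom.comp (castVec d)
  have hφ : ∀ x, φ x = g (castVec d x) - f (castVec d x) := fun x => rfl
  have hb0 : φ b < 0 := by
    have h1 := (linearForm_weight_le hf hf' (faceExp σ)).2.2 fun j hj => faceExp_ne_zero_iff.1 hj
    have h2 := linearForm_weight_le hg hg' (faceExp σ)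
    have h3 := lt_of_le_of_ne h2.1 fun h => hsub fun j hj => h2.2.1 h j (faceExp_ne_zero_iff.2 hj)
    rw [hφ, hb]
    linarith
  obtain ⟨K, hK⟩ := exists_nat_gt ((φ c - φ u) / -φ b)
  refine ⟨K, fun k hk w hw h => ?_⟩
  have h1 := congrArg φ h
  rw [map_add, map_add, map_nsmul, nsmul_eq_mul] at h1
  have h2 : 0 ≤ φ (Finsupp.weight A.col w) := by
    have h3 := (linearForm_weight_le hg hg' w).2.2 hw
    have h4 := (linearForm_weight_le hf hf' w).1
    rw [hφ]
    linarith
  have hk' : (K : ℚ) ≤ k := by exact_mod_cast hk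
  rw [div_lt_iff₀ (by linarith)] at hK
  nlinarith

/-- If the semigroup is a disjoint union of translates of semigroups of faces, then the translates
belonging to a full-dimensional face `σ` represent each class of `ℤ^d` modulo `ℤσ` once. -/
theorem card_eq_latticeIndex {A : Matrix (Fin d) (Fin n) ℤ} (hA : IsAdmissible A)
    {L : Fin n → ℚ} {l : ℕ} (u : Fin l → Fin d → ℤ) (τ : Fin l → Finset (Fin n))
    (hface : ∀ i, IsFace A L (τ i))
    (hcover : ∀ v : Fin n →₀ ℕ, ∃ i, ∃ w : Fin n →₀ ℕ, (∀ j, w j ≠ 0 → j ∈ τ i) ∧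
      Finsupp.weight A.col v = u i + Finsupp.weight A.col w)
    (hdisj : ∀ i i' (w w' : Fin n →₀ ℕ), (∀ j, w j ≠ 0 → j ∈ τ i) → (∀ j, w' j ≠ 0 → j ∈ τ i') →
      u i + Finsupp.weight A.col w = u i' + Finsupp.weight A.col w' → i = i')
    {σ : Finset (Fin n)} (hσ : IsFace A L σ) (hfull : IsFull A σ) :
    Fintype.card {i : Fin l // τ i = σ} = latticeIndex A σ := by
  set Λ := AddSubgroup.closure (A.col '' (σ : Set (Fin n))) with hΛ
  have hmem : ∀ w : Fin n →₀ ℕ, (∀ j, w j ≠ 0 → j ∈ σ) → Finsupp.weight A.col w ∈ Λ := by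
    intro w hw
    rw [Finsupp.weight_eq_sum]
    refine sum_mem fun j _ => ?_
    by_cases hj : w j = 0
    · rw [hj, zero_smul]; exact zero_mem _
    · exact AddSubgroup.nsmul_mem _
        (AddSubgroup.subset_closure (Set.mem_image_of_mem _ (hw j hj))) _
  -- Elements of the lattice are differences of elements of the semigroup of `σ`.
  have hdiff : ∀ z ∈ Λ, ∃ p q : Fin n →₀ ℕ, (∀ j, p j ≠ 0 → j ∈ σ) ∧ (∀ j, q j ≠ 0 → j ∈ σ) ∧
      z = Finsupp.weight A.col p - Finsupp.weight A.col q := by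
    have hor : ∀ {p q : Fin n →₀ ℕ}, (∀ j, p j ≠ 0 → j ∈ σ) → (∀ j, q j ≠ 0 → j ∈ σ) →
        ∀ j, (p + q) j ≠ 0 → j ∈ σ := fun {p q} hp hq j hj => by
      by_cases h : p j = 0
      · exact hq j fun h' => hj (by simp [h, h'])
      · exact hp j h
    intro z hz
    induction hz using AddSubgroup.closure_induction with
    | mem z hz =>
      obtain ⟨j, hj, rfl⟩ := hz
      refine ⟨Finsupp.single j 1, 0, fun i hi => ?_, by simp, by simp [Finsupp.weight_single]⟩
      obtain rfl : j = i := by by_contra h; simp [h] at hi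
      exact hj
    | zero => exact ⟨0, 0, by simp, by simp, by simp⟩
    | add x y _ _ hx hy =>
      obtain ⟨p, q, hp, hq, rfl⟩ := hx
      obtain ⟨p', q', hp', hq', rfl⟩ := hy
      exact ⟨p + p', q + q', hor hp hp', hor hq hq', by rw [map_add, map_add]; abel⟩
    | neg x _ hx =>
      obtain ⟨p, q, hp, hq, rfl⟩ := hx
      exact ⟨q, p, hq, hp, by abel⟩
  rw [Fintype.card_eq_nat_card, latticeIndex, AddSubgroup.index]
  refine Nat.card_eq_of_bijective
    (fun i : {i : Fin l // τ i = σ} => (QuotientAddGroup.mk (u i) : (Fin d → ℤ) ⧸ Λ)) ⟨?_, ?_⟩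
  · rintro ⟨i, hi⟩ ⟨i', hi'⟩ h
    obtain ⟨p, q, hp, hq, hpq⟩ := hdiff _ (QuotientAddGroup.eq.1 h)
    refine Subtype.ext (hdisj i i' p q (hi ▸ hp) (hi' ▸ hq) ?_)
    simp only at hpq
    have : u i' = u i + (Finsupp.weight A.col p - Finsupp.weight A.col q) := by
      rw [← hpq]; abel
    rw [this]; abel
  · intro x
    obtain ⟨c, rfl⟩ := QuotientAddGroup.mk_surjective x
    obtain ⟨K₀, hK₀⟩ := hfull.exists_weight_eq_add hA c
    have hex : ∀ i, ∃ K : ℕ, τ i ≠ σ → ∀ k ≥ K, ∀ w : Fin n →₀ ℕ, (∀ j, w j ≠ 0 → j ∈ τ i) →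
        c + k • Finsupp.weight A.col (faceExp σ) ≠ u i + Finsupp.weight A.col w := fun i => by
      by_cases h : τ i = σ
      · exact ⟨0, fun h' => absurd h h'⟩
      · obtain ⟨K, hK⟩ := hfull.exists_forall_ne hσ (hface i) h c (u i)
        exact ⟨K, fun _ => hK⟩
    choose K hK using hex
    -- Beyond all bounds, the translate of `c` into the cone of `σ` lies in a piece of type `σ`.
    obtain ⟨v, hv⟩ := hK₀ (K₀ + ∑ i, K i) (by omega)
    obtain ⟨i, w, hw, hvw⟩ := hcover v
    have hle : K i ≤ ∑ i, K i := Finset.single_le_sum (fun _ _ => Nat.zero_le _) (Finset.mem_univ i)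
    have hi : τ i = σ := by
      by_contra h
      exact hK i h (K₀ + ∑ i, K i) (by omega) w hw (hv.symm.trans hvw)
    refine ⟨⟨i, hi⟩, QuotientAddGroup.eq.2 ?_⟩
    have : -u i + c = Finsupp.weight A.col w -
        (K₀ + ∑ i, K i) • Finsupp.weight A.col (faceExp σ) := by
      have h1 := hv.symm.trans hvw
      rw [eq_sub_iff_add_eq, add_assoc, h1]
      abel
    simp only
    rw [this]
    exact sub_mem (hmem w (hi ▸ hw)) (AddSubgroup.nsmul_mem _
      (hmem _ fun j hj => faceExp_ne_zero_iff.1 hj) _)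

/-! ### Lengths of localizations -/

section LocalLength

variable {R : Type*} [CommRing R] (P : Ideal R) [P.IsPrime]

/-- The length of the localization of a module at a prime ideal. -/
noncomputable def localLength (M : Type*) [AddCommGroup M] [Module R M] : ℕ∞ :=
  Module.length (Localization.AtPrime P) (LocalizedModule P.primeCompl M)

variable {M N : Type*} [AddCommGroup M] [Module R M] [AddCommGroup N] [Module R N]

theorem localLength_congr (e : M ≃ₗ[R] N) : localLength P M = localLength P N :=
  (LinearEquiv.ofBijective (LocalizedModule.map P.primeCompl e.toLinearMap)
    ⟨LocalizedModule.map_injective _ _ e.injective,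
      LocalizedModule.map_surjective _ _ e.surjective⟩).length_eq

theorem localLength_eq_add (K : Submodule R M) :
    localLength P M = localLength P K + localLength P (M ⧸ K) :=
  Module.length_eq_add_of_exact (LocalizedModule.map P.primeCompl K.subtype)
    (LocalizedModule.map P.primeCompl K.mkQ)
    (LocalizedModule.map_injective _ _ K.injective_subtype)
    (LocalizedModule.map_surjective _ _ K.mkQ_surjective)
    (LocalizedModule.map_exact _ _ _ (LinearMap.exact_subtype_mkQ K))

theorem localLength_eq_zero [Subsingleton M] : localLength P M = 0 := by
  have : Subsingleton (LocalizedModule P.primeCompl M) :=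
    LocalizedModule.subsingleton_iff.2 fun m => ⟨1, one_mem _, Subsingleton.elim _ _⟩
  exact Module.length_eq_zero

theorem localLength_quotient_of_not_le {I : Ideal R} (h : ¬ I ≤ P) : localLength P (R ⧸ I) = 0 := by
  obtain ⟨r, hr, hrP⟩ := Set.not_subset.1 h
  have : Subsingleton (LocalizedModule P.primeCompl (R ⧸ I)) := by
    refine LocalizedModule.subsingleton_iff.2 fun m => ⟨r, hrP, ?_⟩
    obtain ⟨x, rfl⟩ := Ideal.Quotient.mk_surjective m
    rw [← Ideal.Quotient.mk_eq_mk, ← Submodule.Quotient.mk_smul, Submodule.Quotient.mk_eq_zero]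
    exact Ideal.mul_mem_right _ _ hr
  exact Module.length_eq_zero

theorem localLength_quotient_self : localLength P (R ⧸ P) = 1 := by
  refine Module.length_eq_one_iff.2 (isSimpleModule_iff_toSpanSingleton_surjective.2 ⟨?_, ?_⟩)
  · by_contra hcon
    rw [not_nontrivial_iff_subsingleton] at hcon
    obtain ⟨r, hr, h⟩ := LocalizedModule.subsingleton_iff.1 hcon (Ideal.Quotient.mk P 1)
    rw [← Ideal.Quotient.mk_eq_mk, ← Submodule.Quotient.mk_smul, Submodule.Quotient.mk_eq_zero,
      smul_eq_mul, mul_one] at h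
    exact hr h
  · intro m hm m'
    induction m using LocalizedModule.induction_on with | _ x s =>
    induction m' using LocalizedModule.induction_on with | _ y t =>
    obtain ⟨x, rfl⟩ := Ideal.Quotient.mk_surjective x
    obtain ⟨y, rfl⟩ := Ideal.Quotient.mk_surjective y
    have hx : x ∈ P.primeCompl := fun hx => hm (by
      rw [Ideal.Quotient.eq_zero_iff_mem.2 hx, LocalizedModule.zero_mk])
    refine ⟨Localization.mk (y * s) (⟨x, hx⟩ * t), ?_⟩
    rw [LinearMap.toSpanSingleton_apply, LocalizedModule.mk_smul_mk, LocalizedModule.mk_eq]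
    refine ⟨1, ?_⟩
    simp only [one_smul, Submonoid.smul_def, Submonoid.coe_mul, ← Ideal.Quotient.mk_eq_mk,
      ← Submodule.Quotient.mk_smul, smul_eq_mul]
    congr 1
    ring

/-- Along a finite chain of submodules the local lengths of the quotients add up. -/
theorem localLength_eq_sum {l : ℕ} (F : Fin (l + 1) → Submodule R M) (hbot : F 0 = ⊥)
    (htop : F (Fin.last l) = ⊤) (hle : ∀ i : Fin l, F i.castSucc ≤ F i.succ) :
    localLength P M = ∑ i : Fin l,
      localLength P (F i.succ ⧸ (F i.castSucc).submoduleOf (F i.succ)) := by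
  have key : ∀ k (hk : k < l + 1), localLength P (F ⟨k, hk⟩) = ∑ i : Fin k,
      localLength P (F ⟨i + 1, Nat.lt_of_le_of_lt i.2 hk⟩ ⧸
        (F ⟨i, i.2.trans hk⟩).submoduleOf (F ⟨i + 1, Nat.lt_of_le_of_lt i.2 hk⟩)) := by
    intro k
    induction k with
    | zero =>
      intro hk
      have : F ⟨0, hk⟩ = ⊥ := hbot
      rw [this]
      simpa using localLength_eq_zero P
    | succ k ih =>
      intro hk
      rw [Fin.sum_univ_castSucc]
      have hle' : F ⟨k, by omega⟩ ≤ F ⟨k + 1, hk⟩ := hle ⟨k, by omega⟩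
      rw [localLength_eq_add P ((F ⟨k, by omega⟩).submoduleOf (F ⟨k + 1, hk⟩)),
        localLength_congr P (Submodule.submoduleOfEquivOfLe hle'), ih]
      rfl
  rw [← localLength_congr P (Submodule.topEquiv (R := R) (M := M)), ← htop]
  exact key l (Nat.lt_succ_self l)

end LocalLength

/-- The length of `S_A^L` at the prime of a facet is the multiplicity of the facet in any
composition chain: all other quotients of the chain vanish at this prime. -/
theorem IsCompositionChain.lengthAt_eq {A : Matrix (Fin d) (Fin n) ℤ} (hA : IsAdmissible A)
    {L : Fin n → ℚ} {l : ℕ} {N : Fin (l + 1) → Submodule (MvPolynomial (Fin n) ℂ)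
      (GradedToricRing A L)} {τ : Fin l → Finset (Fin n)} {u : Fin l → Fin d → ℤ}
    (H : IsCompositionChain A L l N τ u) {σ : Finset (Fin n)} (hσ : IsFace A L σ)
    (hfull : IsFull A σ) [(toricIdeal A σ).IsPrime] :
    lengthAt (gradedIdeal A L) (toricIdeal A σ) = Fintype.card {i : Fin l // τ i = σ} := by
  have h1 : ∀ i : Fin l, localLength (toricIdeal A σ)
      (N i.succ ⧸ (N i.castSucc).submoduleOf (N i.succ)) = if τ i = σ then 1 else 0 := fun i => by
    obtain ⟨e, -⟩ := H.quotient i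
    rw [← localLength_congr _ e]
    split_ifs with h
    · rw [h, localLength_quotient_self]
    · refine localLength_quotient_of_not_le _ fun hle => h ?_
      exact (hfull.eq_of_subset hσ ((mem_umbrella_iff hA).1 (H.mem_umbrella i))
        (subset_of_toricIdeal_le hle)).symm
  refine (localLength_eq_sum (toricIdeal A σ) N H.bot H.top H.le).trans ?_
  simp only [h1]
  rw [Finset.sum_ite, Finset.sum_const_zero, add_zero, Finset.sum_const, nsmul_one,
    Fintype.card_subtype]

/-- The composition chain of a toric filtration of `S_A^L`, with the multiplicities of its
facets. -/
theorem exists_isCompositionChain {A : Matrix (Fin d) (Fin n) ℤ} (hA : IsAdmissible A)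
    (L : Fin n → ℚ) : ∃ l N τ u, IsCompositionChain A L l N τ u ∧
      ∀ σ, IsFace A L σ → IsFull A σ →
        Fintype.card {i : Fin l // τ i = σ} = latticeIndex A σ := by
  obtain ⟨l, P, s, τ, H⟩ := (isStable_isMinExp A L).exists_isToricFiltration
  have hc := H.isCompositionChain hA
  refine ⟨l, _, _, _, hc, fun σ hσ hfull => card_eq_latticeIndex hA
    (fun k => Finsupp.weight A.col (s k)) _
    (fun i => (mem_umbrella_iff hA).1 (hc.mem_umbrella i)) (fun v => ?_) ?_ hσ hfull⟩
  · obtain ⟨v', hv', hvv⟩ := exists_isMinExp hA L v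
    obtain ⟨k, hk, w, hw, h⟩ := H.exists_weight_eq hv'
    exact ⟨⟨k, hk⟩, w, hw, by rw [← hvv, h]⟩
  · intro i i' w w' hw hw' h
    exact Fin.ext (H.eq_of_weight_eq i.2 i'.2 hw hw' h)

theorem lengthAt_toricIdeal {A : Matrix (Fin d) (Fin n) ℤ} (hA : IsAdmissible A) {L : Fin n → ℚ}
    {σ : Finset (Fin n)} (hσ : IsFace A L σ) (hfull : IsFull A σ) [(toricIdeal A σ).IsPrime] :
    lengthAt (gradedIdeal A L) (toricIdeal A σ) = latticeIndex A σ := by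
  obtain ⟨l, N, τ, u, hc, hcard⟩ := exists_isCompositionChain hA L
  rw [hc.lengthAt_eq hA hσ hfull, hcard σ hσ hfull]

/-! ### Krull dimensions of toric rings -/

/-- An injective integral extension preserves the Krull dimension. -/
theorem ringKrullDim_eq_of_isIntegral (R S : Type*) [CommRing R] [CommRing S] [Algebra R S]
    [Algebra.IsIntegral R S] [FaithfulSMul R S] : ringKrullDim S = ringKrullDim R := by
  apply le_antisymm
  · refine Order.krullDim_le_of_strictMono (PrimeSpectrum.comap (algebraMap R S)) fun P Q h => ?_
    have := P.isPrime
    exact Ideal.IsIntegral.comap_lt_comap (R := R) (I := P.asIdeal) (J := Q.asIdeal) h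
  · refine iSup_le fun l => ?_
    obtain ⟨P, hP⟩ := Algebra.IsIntegral.comap_surjective R S l.head
    have : P.asIdeal.LiesOver l.head.asIdeal := ⟨by rw [← hP]; rfl⟩
    obtain ⟨l', hl', -⟩ := Ideal.exists_ltSeries_of_hasGoingUp l P.asIdeal
    rw [← hl']
    exact Order.LTSeries.length_le_krullDim l'

/-- The Krull dimension of an affine domain is its transcendence degree. -/
theorem ringKrullDim_eq_of_trdeg_eq (k S : Type) [Field k] [CommRing S] [IsDomain S] [Algebra k S]
    [Algebra.FiniteType k S] {r : ℕ} (h : Algebra.trdeg k S = r) : ringKrullDim S = r := by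
  obtain ⟨s, g, hg, hint⟩ := exists_integral_inj_algHom_of_fg k S
  let := g.toRingHom.toAlgebra
  have : IsScalarTower k (MvPolynomial (Fin s) k) S :=
    IsScalarTower.of_algebraMap_eq fun x => (g.commutes x).symm
  have : Algebra.IsIntegral (MvPolynomial (Fin s) k) S := ⟨hint⟩
  have : FaithfulSMul (MvPolynomial (Fin s) k) S := (faithfulSMul_iff_algebraMap_injective _ _).2 hg
  have h1 := trdeg_add_eq k (MvPolynomial (Fin s) k) (A := S)
  rw [trdeg_eq_zero (R := MvPolynomial (Fin s) k) (A := S),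
    MvPolynomial.trdeg_of_isDomain, h] at h1
  have hs : s = r := by
    simpa using h1
  rw [ringKrullDim_eq_of_isIntegral (MvPolynomial (Fin s) k) S,
    MvPolynomial.ringKrullDim_of_isNoetherianRing, ringKrullDim_eq_zero_of_field, hs]
  simp

theorem toricIdeal_mk_monomial_eq {A : Matrix (Fin d) (Fin n) ℤ} {τ : Finset (Fin n)}
    {u v : Fin n →₀ ℕ} (hu : ∀ j, u j ≠ 0 → j ∈ τ) (hv : ∀ j, v j ≠ 0 → j ∈ τ)
    (huv : Finsupp.weight A.col u = Finsupp.weight A.col v) :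
    Ideal.Quotient.mk (toricIdeal A τ) (monomial u 1) =
      Ideal.Quotient.mk (toricIdeal A τ) (monomial v 1) := by
  rw [Ideal.Quotient.eq, toricIdeal_eq_fiberIdeal]
  exact sub_mem_fiberIdeal hu hv huv

/-- The classes of variables with linearly independent columns form a transcendence basis of the
toric ring if their columns span those of all other variables. -/
theorem trdeg_toricRing {A : Matrix (Fin d) (Fin n) ℤ} {τ : Finset (Fin n)} :
    Algebra.trdeg ℂ (MvPolynomial (Fin n) ℂ ⧸ toricIdeal A τ) =
      (Module.finrank ℚ (Submodule.span ℚ (ratCol A '' (τ : Set (Fin n)))) : ℕ) := by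
  classical
  have := toricIdeal_isPrime A τ
  obtain ⟨κ, a, ha, hspan, hli⟩ := exists_linearIndependent' ℚ fun j : τ => ratCol A j
  have hfin : Finite κ := Finite.of_injective a ha
  have := Fintype.ofFinite κ
  let b : κ → Fin n := fun i => (a i : Fin n)
  have hbτ : ∀ i, b i ∈ τ := fun i => (a i).2
  have hb : Function.Injective b := Subtype.val_injective.comp ha
  have hrange : (Set.range fun j : τ => ratCol A j) = ratCol A '' (τ : Set (Fin n)) := by
    ext x; simp
  have hcard : Module.finrank ℚ (Submodule.span ℚ (ratCol A '' (τ : Set (Fin n)))) =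
      Fintype.card κ := by
    rw [← hrange, ← hspan]
    exact finrank_span_eq_card hli
  let x : Fin n → MvPolynomial (Fin n) ℂ ⧸ toricIdeal A τ := fun j => Ideal.Quotient.mk _ (X j)
  have hxmon : ∀ u : Fin n →₀ ℕ, Ideal.Quotient.mk (toricIdeal A τ) (monomial u 1) =
      ∏ j, x j ^ u j := fun u => by
    rw [monomial_eq, C_1, one_mul, Finsupp.prod_fintype _ _ (by simp), map_prod]
    simp only [map_pow, x]
  have hmap : ∀ u : κ →₀ ℕ, ∀ j, u.mapDomain b j ≠ 0 → j ∈ τ := fun u j hj => by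
    by_contra hjτ
    refine hj (Finsupp.mapDomain_of_notMem_range _ _ ?_)
    rintro ⟨i, rfl⟩
    exact hjτ (hbτ i)
  -- Algebraic independence: distinct monomials in the basis variables have distinct degrees.
  have hwt : Function.Injective fun u : κ →₀ ℕ => Finsupp.weight A.col (u.mapDomain b) := by
    intro u v huv
    have h1 : ∀ u : κ →₀ ℕ, castVec d (Finsupp.weight A.col (u.mapDomain b)) =
        ∑ i, (u i : ℚ) • ratCol A (b i) := fun u => by
      rw [castVec_weight]
      rw [← Finset.sum_subset (Finset.subset_univ (Finset.univ.image b)),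
        Finset.sum_image fun i _ j _ h => hb h]
      · simp only [Finsupp.mapDomain_apply hb]
      · intro j _ hj
        rw [Finsupp.mapDomain_of_notMem_range]
        · simp
        · rintro ⟨i, rfl⟩; exact hj (Finset.mem_image_of_mem _ (Finset.mem_univ i))
    have h2 : ∑ i, (u i : ℚ) • ratCol A (b i) = ∑ i, (v i : ℚ) • ratCol A (b i) := by
      rw [← h1, ← h1]; exact congrArg _ huv
    have h3 := Fintype.linearIndependent_iff.1 hli (fun i => (u i : ℚ) - v i) (by
      simp only [sub_smul, Finset.sum_sub_distrib]
      exact sub_eq_zero.2 h2)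
    ext i
    have := h3 i
    rw [sub_eq_zero] at this
    exact_mod_cast this
  have hind : AlgebraicIndependent ℂ fun i => x (b i) := by
    rw [AlgebraicIndependent, injective_iff_map_eq_zero]
    intro f hf
    have h1 : aeval (fun i => x (b i)) f = Ideal.Quotient.mk (toricIdeal A τ) (rename b f) := by
      have : (aeval (fun i => x (b i)) : MvPolynomial κ ℂ →ₐ[ℂ] _) =
          (Ideal.Quotient.mkₐ ℂ (toricIdeal A τ)).comp (rename b) := by
        refine MvPolynomial.algHom_ext fun i => ?_
        simp [x]
      rw [this]; rfl
    rw [h1, Ideal.Quotient.eq_zero_iff_mem, mem_toricIdeal_iff] at hf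
    have h2 : ∀ f : MvPolynomial κ ℂ, degMap A (fun u => ∀ j, u j ≠ 0 → j ∈ τ) (rename b f) =
        ∑ u ∈ f.support, Finsupp.single (Finsupp.weight A.col (u.mapDomain b)) (coeff u f) := by
      intro f
      conv_lhs => rw [as_sum f, map_sum, map_sum]
      refine Finset.sum_congr rfl fun u _ => ?_
      rw [rename_monomial, degMap_monomial_of_pos A (hmap u)]
    rw [h2] at hf
    ext u
    rw [coeff_zero]
    have h3 := DFunLike.congr_fun hf (Finsupp.weight A.col (u.mapDomain b))
    rw [Finsupp.finsetSum_apply, Finsupp.zero_apply] at h3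
    by_cases hu : u ∈ f.support
    · rw [Finset.sum_eq_single_of_mem u hu] at h3
      · simpa using h3
      · intro v _ hvu
        exact Finsupp.single_eq_of_ne fun h => hvu (hwt h).symm
    · exact notMem_support_iff.1 hu
  -- Algebraicity: a linear relation between columns, with denominators cleared, is a monomial
  -- equation `∂^q ∂_j^m = ∂^p` in the toric ring.
  have halg : Algebra.IsAlgebraic (Algebra.adjoin ℂ (Set.range fun i => x (b i)))
      (MvPolynomial (Fin n) ℂ ⧸ toricIdeal A τ) := by
    set B := Algebra.adjoin ℂ (Set.range fun i => x (b i)) with hB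
    have hmonB : ∀ u : κ →₀ ℕ,
        Ideal.Quotient.mk (toricIdeal A τ) (monomial (u.mapDomain b) 1) ∈ B := fun u => by
      rw [hxmon]
      refine prod_mem fun j _ => ?_
      by_cases hj : j ∈ Set.range b
      · obtain ⟨i, rfl⟩ := hj
        exact pow_mem (Algebra.subset_adjoin (Set.mem_range_self i)) _
      · rw [Finsupp.mapDomain_of_notMem_range _ _ hj, pow_zero]
        exact one_mem _
    have hxalg : ∀ j, IsAlgebraic B (x j) := fun j => by
      by_cases hj : j ∈ τ
      · have hmem : ratCol A j ∈ Submodule.span ℚ (Set.range fun i => ratCol A (b i)) := by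
          have h1 : ratCol A j ∈ Submodule.span ℚ (Set.range fun j : τ => ratCol A j) :=
            Submodule.subset_span ⟨⟨j, hj⟩, rfl⟩
          rw [← hspan] at h1
          exact h1
        obtain ⟨c, hc⟩ := (Submodule.mem_span_range_iff_exists_fun ℚ).1 hmem
        obtain ⟨m, hm, z, hz⟩ := exists_common_denom c
        let p : κ →₀ ℕ := Finsupp.equivFunOnFinite.symm fun i => (z i).toNat
        let q : κ →₀ ℕ := Finsupp.equivFunOnFinite.symm fun i => (-z i).toNat
        have hcol : ∀ u : κ →₀ ℕ, Finsupp.weight A.col (u.mapDomain b) =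
            ∑ i, u i • A.col (b i) := fun u => by
          rw [Finsupp.weight_apply, Finsupp.sum_mapDomain_index (by simp)
            (fun _ _ _ => add_smul _ _ _), Finsupp.sum_fintype _ _ (by simp)]
        have hrel : m • A.col j + Finsupp.weight A.col (q.mapDomain b) =
            Finsupp.weight A.col (p.mapDomain b) := by
          rw [hcol, hcol, ← eq_sub_iff_add_eq, ← Finset.sum_sub_distrib]
          apply castVec_injective
          rw [map_nsmul, castVec_col, ← hc, map_sum, ← Nat.cast_smul_eq_nsmul ℚ, Finset.smul_sum]
          refine Finset.sum_congr rfl fun i _ => ?_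
          rw [smul_smul, hz, map_sub, map_nsmul, map_nsmul, castVec_col,
            ← Nat.cast_smul_eq_nsmul ℚ, ← Nat.cast_smul_eq_nsmul ℚ, ← sub_smul]
          congr 1
          have : z i = (p i : ℤ) - q i := by
            simp only [p, q, Finsupp.equivFunOnFinite_symm_apply_apply]; omega
          rw [this]; push_cast; ring
        have heq : Ideal.Quotient.mk (toricIdeal A τ) (monomial (q.mapDomain b) 1) * x j ^ m =
            Ideal.Quotient.mk (toricIdeal A τ) (monomial (p.mapDomain b) 1) := by
          have h1 : x j ^ m = Ideal.Quotient.mk (toricIdeal A τ)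
              (monomial (Finsupp.single j m) 1) := by
            rw [← X_pow_eq_monomial, map_pow]
          rw [h1, ← map_mul, monomial_mul, one_mul]
          refine toricIdeal_mk_monomial_eq (fun i hi => ?_) (hmap p) ?_
          · by_cases hij : j = i
            · exact hij ▸ hj
            · exact hmap q i (by simpa [Finsupp.single_apply, hij] using hi)
          · rw [map_add, Finsupp.weight_single, add_comm, ← hrel]
        have hq0 : (⟨_, hmonB q⟩ : B) ≠ 0 := fun h => by
          have := congrArg Subtype.val h
          exact monomial_mem_toricIdeal_iff.1 (Ideal.Quotient.eq_zero_iff_mem.1 this) (hmap q)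
        refine ⟨Polynomial.C ⟨_, hmonB q⟩ * Polynomial.X ^ m - Polynomial.C ⟨_, hmonB p⟩,
          fun h0 => hq0 ?_, ?_⟩
        · have := congrArg (Polynomial.coeff · m) h0
          simpa [Polynomial.coeff_C, hm.ne'] using this
        · simp only [map_sub, map_mul, map_pow, Polynomial.aeval_C, Polynomial.aeval_X]
          exact sub_eq_zero.2 heq
      · have : x j = 0 := Ideal.Quotient.eq_zero_iff_mem.2 (X_mem_toricIdeal_iff.2 hj)
        rw [this]
        exact isAlgebraic_zero
    refine ⟨fun y => ?_⟩
    obtain ⟨f, rfl⟩ := Ideal.Quotient.mk_surjective y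
    rw [← Subalgebra.mem_algebraicClosure]
    induction f using MvPolynomial.induction_on with
    | C a =>
      exact isAlgebraic_algebraMap (algebraMap ℂ B a)
    | add p q hp hq => rw [map_add]; exact add_mem hp hq
    | mul_X p j hp => rw [map_mul]; exact mul_mem hp (hxalg j)
  rw [hcard]
  apply le_antisymm
  · exact (Algebra.IsAlgebraic.trdeg_le_cardinalMk ℂ (Set.range fun i => x (b i))).trans
      (Cardinal.mk_range_le.trans_eq (Cardinal.mk_fintype κ))
  · exact (Cardinal.mk_fintype κ).symm.le.trans hind.cardinalMk_le_trdeg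

theorem ringKrullDim_toricRing (A : Matrix (Fin d) (Fin n) ℤ) (τ : Finset (Fin n)) :
    ringKrullDim (MvPolynomial (Fin n) ℂ ⧸ toricIdeal A τ) =
      (Module.finrank ℚ (Submodule.span ℚ (ratCol A '' (τ : Set (Fin n)))) : ℕ) := by
  have := toricIdeal_isPrime A τ
  exact ringKrullDim_eq_of_trdeg_eq ℂ _ trdeg_toricRing

/-! ### Irreducible components and the degree -/

/-- Each prime ideal containing the initial ideal contains the toric ideal of some face. -/
theorem exists_toricIdeal_le {A : Matrix (Fin d) (Fin n) ℤ} {L : Fin n → ℚ}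
    {P : Ideal (MvPolynomial (Fin n) ℂ)} (hP : P.IsPrime) (hle : gradedIdeal A L ≤ P) :
    ∃ τ, IsFace A L τ ∧ toricIdeal A τ ≤ P := by
  classical
  exact ⟨_, isFace_of_isPrime (τ := Finset.univ.filter fun j => X j ∉ P) hle (by simp)⟩

theorem IsFull.toricIdeal_mem_minimalPrimes {A : Matrix (Fin d) (Fin n) ℤ} {L : Fin n → ℚ}
    {σ : Finset (Fin n)} (hfull : IsFull A σ) (hσ : IsFace A L σ) :
    toricIdeal A σ ∈ (gradedIdeal A L).minimalPrimes := by
  refine ⟨⟨toricIdeal_isPrime A σ, hσ.gradedIdeal_le_toricIdeal⟩, fun Q hQ hQσ => ?_⟩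
  obtain ⟨τ, hτ, hτQ⟩ := exists_toricIdeal_le hQ.1 hQ.2
  rwa [hfull.eq_of_subset hσ hτ (subset_of_toricIdeal_le (hτQ.trans hQσ))]

theorem finrank_span_ratCol_le (A : Matrix (Fin d) (Fin n) ℤ) (τ : Finset (Fin n)) :
    Module.finrank ℚ (Submodule.span ℚ (ratCol A '' (τ : Set (Fin n)))) ≤ d :=
  (Submodule.finrank_le _).trans_eq (by simp)

theorem ringKrullDim_gradedToricRing {A : Matrix (Fin d) (Fin n) ℤ} (hA : IsAdmissible A)
    (L : Fin n → ℚ) : ringKrullDim (MvPolynomial (Fin n) ℂ ⧸ gradedIdeal A L) = (d : ℕ) := by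
  apply le_antisymm
  · rw [ringKrullDim_quotient, Order.krullDim_eq_iSup_coheight]
    refine iSup_le fun Q => ?_
    rw [Order.coheight_eq_krullDim_Ici]
    obtain ⟨τ, -, hτ⟩ := exists_toricIdeal_le Q.1.isPrime Q.2
    calc Order.krullDim (Set.Ici Q)
        ≤ Order.krullDim (PrimeSpectrum.zeroLocus
            (toricIdeal A τ : Set (MvPolynomial (Fin n) ℂ))) :=
          Order.krullDim_le_of_strictMono
            (fun x => ⟨x.1.1, fun f hf => x.2 (hτ hf)⟩) fun x y h => h
      _ = ringKrullDim (MvPolynomial (Fin n) ℂ ⧸ toricIdeal A τ) :=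
          (ringKrullDim_quotient _).symm
      _ ≤ (d : ℕ) := by
          rw [ringKrullDim_toricRing]
          exact_mod_cast finrank_span_ratCol_le A τ
  · obtain ⟨σ, hσ, hfull⟩ := exists_isFace_isFull hA L
    have h := ringKrullDim_le_of_surjective (Ideal.Quotient.factor hσ.gradedIdeal_le_toricIdeal)
      (Ideal.Quotient.factor_surjective _)
    rwa [ringKrullDim_toricRing, isFull_iff_finrank.1 hfull] at h

/-- The top-dimensional components of `S_A^L` are the orbit closures of the facets. -/
theorem bijOn_facets_topComponents {A : Matrix (Fin d) (Fin n) ℤ} (hA : IsAdmissible A)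
    (L : Fin n → ℚ) :
    Set.BijOn (fun σ => (⟨toricIdeal A σ, toricIdeal_isPrime A σ⟩ :
      PrimeSpectrum (MvPolynomial (Fin n) ℂ))) (facets A L) (topComponents (gradedIdeal A L)) := by
  refine ⟨fun σ hσ => ?_, fun σ _ τ _ h => ?_, fun P hP => ?_⟩
  · obtain ⟨hσ, hfull⟩ := (mem_facets_iff hA).1 hσ
    refine ⟨hfull.toricIdeal_mem_minimalPrimes hσ, ?_⟩
    rw [ringKrullDim_gradedToricRing hA, ringKrullDim_toricRing, isFull_iff_finrank.1 hfull]
  · exact toricIdeal_injective A (congrArg PrimeSpectrum.asIdeal h)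
  · obtain ⟨hmin, hdim⟩ := hP
    obtain ⟨τ, hτ, hle⟩ := exists_toricIdeal_le P.isPrime hmin.1.2
    have heq : toricIdeal A τ = P.asIdeal := le_antisymm hle
      (hmin.2 ⟨toricIdeal_isPrime A τ, hτ.gradedIdeal_le_toricIdeal⟩ hle)
    refine ⟨τ, (mem_facets_iff hA).2 ⟨hτ, isFull_iff_finrank.2 ?_⟩, PrimeSpectrum.ext heq⟩
    rw [← heq, ringKrullDim_gradedToricRing hA, ringKrullDim_toricRing] at hdim
    exact_mod_cast hdim

theorem degree_gradedIdeal {A : Matrix (Fin d) (Fin n) ℤ} (hA : IsAdmissible A)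
    (L : Fin n → ℚ) :
    degree (gradedIdeal A L) = ∑ᶠ σ ∈ facets A L, (latticeIndex A σ : ℕ∞) := by
  refine (finsum_mem_eq_of_bijOn _ (bijOn_facets_topComponents hA L) fun σ hσ => ?_).symm
  obtain ⟨hσ, hfull⟩ := (mem_facets_iff hA).1 hσ
  have := toricIdeal_isPrime A σ
  exact (lengthAt_toricIdeal hA hσ hfull).symm

end Umbrella

open Umbrella in
theorem mainTheorem10 {d n : ℕ} (A : Matrix (Fin d) (Fin n) ℤ) (hA : IsAdmissible A)
    (L : Fin n → ℚ) :
    (∃ l N τ u, IsCompositionChain A L l N τ u) ∧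
    (∀ σ ∈ facets A L,
      (∀ l N τ u, IsCompositionChain A L l N τ u →
        Fintype.card {i : Fin l // τ i = σ} = latticeIndex A σ) ∧
      ∃ _ : (vanishingIdeal ℂ (zariskiClosure (orbit A σ))).IsPrime,
        lengthAt (gradedIdeal A L) (vanishingIdeal ℂ (zariskiClosure (orbit A σ))) =
          (latticeIndex A σ : ℕ∞)) ∧
    degree (gradedIdeal A L) = ∑ᶠ σ ∈ facets A L, (latticeIndex A σ : ℕ∞) := by
  refine ⟨?_, fun σ hσ => ?_, degree_gradedIdeal hA L⟩
  · obtain ⟨l, N, τ, u, h, -⟩ := exists_isCompositionChain hA L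
    exact ⟨l, N, τ, u, h⟩
  · obtain ⟨hface, hfull⟩ := (mem_facets_iff hA).1 hσ
    have hprime := toricIdeal_isPrime A σ
    have hlen := lengthAt_toricIdeal hA hface hfull
    refine ⟨fun l N τ u h => ?_, ?_⟩
    · exact_mod_cast (h.lengthAt_eq hA hface hfull).symm.trans hlen
    · simp only [vanishingIdeal_zariskiClosure_orbit]
      exact ⟨hprime, hlen⟩
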